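/- Let $n\ge 1$, $\theta\in(0,\pi/2)$, let $E_{n+1}$ be the last unit coordinate vector of $\mathbb{R}^{n+1}$, $e=-E_{n+1}$, $\mathbb{R}^{n+1}_+=\{x_{n+1}>0\}$. Let $\widehat\Sigma$ be a capillary convex body with contact angle $\theta$, that is, a convex body (compact, convex, with nonempty interior) contained in $\overline{\mathbb{R}^{n+1}_+}$ whose boundary consists of a flat face $\widehat{\partial\Sigma}\subset\partial\mathbb{R}^{n+1}_+$ and of a smooth compact hypersurface $\Sigma$, the closure of $\partial\widehat\Sigma\cap\mathbb{R}^{n+1}_+$, with nonempty boundary $\partial\Sigma=\Sigma\cap\partial\mathbb{R}^{n+1}_+$, such that the unit normal $\nu$ of $\Sigma$ pointing out of $\widehat\Sigma$ satisfies $\langle\nu,e\rangle=\cos(\pi-\theta)$ along $\partial\Sigma$. Put $$\mathcal{C}_\theta=\{\xi\in\overline{\mathbb{R}^{n+1}_+} : |\xi-\cos\theta\, e|=1\},\qquad \ell(\xi)=\sin^2\theta+\cos\theta\,\langle\xi,e\rangle,$$ and for $z$ in the interior $\mathrm{int}(\widehat{\partial\Sigma})$ of the flat face relative to $\partial\mathbb{R}^{n+1}_+$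 let $$u_z(\xi)=\frac{1}{\ell(\xi)}\max_{X\in\Sigma}\langle \xi-\cos\theta\, e,\,X-z\rangle\quad(\xi\in\mathcal{C}_\theta)$$ be the capillary support function of $\Sigma$ with respect to $z$, and $$\widehat\Sigma^*_z=\{r\xi+z\in\overline{\mathbb{R}^{n+1}_+} : r\ge 0,\ \xi\in\mathcal{C}_\theta,\ r\,u_z(\xi)\le 1\}$$ the capillary polar body with respect to $z$. Then $$\inf_{z\in\mathrm{int}(\widehat{\partial\Sigma})}\mathrm{Vol}(\widehat\Sigma)\,\mathrm{Vol}(\widehat\Sigma^*_z)\;\le\;\tfrac12\,\mathrm{Vol}(\mathbb{B}^{n+1})^2,$$ where $\mathbb{B}^{n+1}$ is the unit ball of $\mathbb{R}^{n+1}$. -/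

import Mathlib

open scoped ENNReal Topology ContDiff RealInnerProductSpace

noncomputable section

namespace Capillary

/-- Euclidean space `ℝ^{n+1}`; the last coordinate is the height. -/
abbrev Space (n : ℕ) : Type := EuclideanSpace ℝ (Fin (n + 1))

variable {n : ℕ}

/-- The height coordinate `x_{n+1}`. -/
def height (x : Space n) : ℝ := x (Fin.last n)

/-- The downward unit vector `e = -E_{n+1}`. -/
def e (n : ℕ) : Space n := -EuclideanSpace.single (Fin.last n) (1 : ℝ)

/-- The open upper half-space `{x_{n+1} > 0}`. -/
def openHalfSpace (n : ℕ) : Set (Space n) := {x | 0 < height x}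

/-- The closed upper half-space `{x_{n+1} ≥ 0}`. -/
def closedHalfSpace (n : ℕ) : Set (Space n) := {x | 0 ≤ height x}

/-- The supporting hyperplane `{x_{n+1} = 0}`, the boundary of the half-space. -/
def hyperplane (n : ℕ) : Set (Space n) := {x | height x = 0}

/-- The hypersurface `Σ` of a body `K` in the closed half-space: the part of the boundary of `K`
above the hyperplane, together with its boundary `∂Σ` on the hyperplane. -/
def surface (K : Set (Space n)) : Set (Space n) := closure (frontier K ∩ openHalfSpace n)

/-- The flat face of `K`, i.e. the part of its boundary lying on the hyperplane. -/
def flatFace (K : Set (Space n)) : Set (Space n) := frontier K ∩ hyperplane n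

/-- The interior of the flat face, relative to the hyperplane. -/
def flatInterior (K : Set (Space n)) : Set (Space n) :=
  {z | z ∈ hyperplane n ∧ flatFace K ∈ 𝓝[hyperplane n] z}

/-- Near the point `p`, the body `K` is the part lying in the closed half-space of a sublevel set
`{f ≤ 0}` of a smooth function `f` with `∇f(p) ≠ 0`, and `ν = ∇f(p) / |∇f(p)|`. For `p` on the
surface `Σ` of `K` this says that `Σ` is, near `p`, a smooth hypersurface
(up to the hyperplane if `p` lies on it) and that `ν` is its unit normal at `p` pointing out of
`K`. -/
def IsOuterUnitNormal (K : Set (Space n)) (p ν : Space n) : Prop :=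
  ∃ (U : Set (Space n)) (f : Space n → ℝ), IsOpen U ∧ p ∈ U ∧ ContDiffOn ℝ ∞ f U ∧
    K ∩ U = {x | x ∈ U ∧ x ∈ closedHalfSpace n ∧ f x ≤ 0} ∧
    gradient f p ≠ 0 ∧ ν = ‖gradient f p‖⁻¹ • gradient f p

/-- `K` is a capillary convex body with contact angle `θ`: a convex body in the closed upper
half-space, whose boundary consists of a flat face on the hyperplane and of a smooth
hypersurface `Σ` with nonempty boundary `∂Σ = Σ ∩ {x_{n+1} = 0}`, along which `Σ` makes the
constant contact angle `θ` with the hyperplane, `⟨ν, e⟩ = cos (π - θ)`. -/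
structure IsCapillaryConvexBody (θ : ℝ) (K : Set (Space n)) : Prop where
  isCompact : IsCompact K
  convex : Convex ℝ K
  interior_nonempty : (interior K).Nonempty
  subset_halfSpace : K ⊆ closedHalfSpace n
  boundary_nonempty : (surface K ∩ hyperplane n).Nonempty
  smooth_contact : ∀ p ∈ surface K, ∃ ν : Space n, IsOuterUnitNormal K p ν ∧
    (p ∈ hyperplane n → ⟪ν, e n⟫ = Real.cos (Real.pi - θ))

/-- The unit spherical cap `C_θ`. -/
def cap (n : ℕ) (θ : ℝ) : Set (Space n) :=
  {ξ | ξ ∈ closedHalfSpace n ∧ ‖ξ - Real.cos θ • e n‖ = 1}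

/-- `ℓ(ξ) = sin² θ + cos θ ⟨ξ, e⟩`. -/
def ell (θ : ℝ) (ξ : Space n) : ℝ := Real.sin θ ^ 2 + Real.cos θ * ⟪ξ, e n⟫

/-- The support function `h_z(ξ) = max_{X ∈ Σ} ⟨ξ - cos θ e, X - z⟩` of `Σ` with respect
to `z`. -/
def support (θ : ℝ) (K : Set (Space n)) (z ξ : Space n) : ℝ :=
  sSup ((fun X : Space n => ⟪ξ - Real.cos θ • e n, X - z⟫) '' surface K)

/-- The capillary support function `u_z = h_z / ℓ`. -/
def capillarySupport (θ : ℝ) (K : Set (Space n)) (z ξ : Space n) : ℝ :=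
  support θ K z ξ / ell θ ξ

/-- The capillary polar body of `K` with respect to `z`: all points `X + z` of the closed
half-space with `X = r ξ`, `r ≥ 0`, `ξ ∈ C_θ` and `r u_z(ξ) ≤ 1`. -/
def polarBody (θ : ℝ) (K : Set (Space n)) (z : Space n) : Set (Space n) :=
  {Y | Y ∈ closedHalfSpace n ∧ ∃ r : ℝ, 0 ≤ r ∧ ∃ ξ ∈ cap n θ,
    r * capillarySupport θ K z ξ ≤ 1 ∧ Y = r • ξ + z}

end Capillary

end

/-! Let `z` be the vertical projection of the barycenter of `K` to the hyperplane. Acuteness of the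
contact angle forces `K` to contain the vertical projection of each of its points
(`projection_mem`), so `z` is interior to the flat face.

A point `r ξ` of the translated polar body is the image of `W = r (ξ - cos θ e)` under `capShift`,
that is `W ↦ W + cos θ |W| e`. Since `ell ≤ 1`, this `W` has pairing at most `1` with every `X - z`,
`X ∈ K` above the hyperplane; moreover `W` has positive height. On the upper half-space the Jacobian
of `capShift` lies between `0` and `1`, so the polar body has at most the volume of the ordinary
polar set cut by the half-space (`polarBody_subset`, `volume_capShift_image_le`).

It remains to bound the volume product of two mutually polar sets in a half-space, the first with
barycenter on the vertical axis (`volume_mul_volume_le_of_height_pos`). The bound is `vol(B)² / 4`,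
a quarter of the classical one, and is better than the claimed half. It comes from a functional
inequality: Prékopa's inequality on vertical half-lines gives a factor `π / 2`, and the functional
Santaló inequality handles the horizontal variables.

The functional Santaló inequality is itself proved by induction on the dimension, following Lehec. A
hyperplane halves the mass of `g`, a shear centers both halves on a common axis, and the half-space
inequality from the lower dimension applies to each half. -/

open MeasureTheory

/-! ### Prékopa's inequality in dimension one. -/

/-- One-dimensional Brunn–Minkowski inequality for compact sets. -/
theorem volume_add_volume_le_of_isCompact {A B S : Set ℝ} (hA : IsCompact A) (hB : IsCompact B)
    (hA₀ : A.Nonempty) (hB₀ : B.Nonempty) (h : ∀ a ∈ A, ∀ b ∈ B, a + b ∈ S) :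
    volume A + volume B ≤ volume S := by
  obtain ⟨a, ha, ha'⟩ := hA.exists_isGreatest hA₀
  obtain ⟨b, hb, hb'⟩ := hB.exists_isLeast hB₀
  have h1 : volume ((fun x => x + b) '' A) = volume A := by
    rw [Set.image_add_right, measure_preimage_add_right]
  have h2 : volume ((fun x => a + x) '' B) = volume B := by
    rw [Set.image_add_left, measure_preimage_add]
  -- With `a = max A` and `b = min B`, the translates `A + b` and `a + B` lie on opposite sides of
  -- `a + b`.
  have hd : AEDisjoint volume ((fun x => x + b) '' A) ((fun x => a + x) '' B) := by
    refine measure_mono_null (t := {a + b}) ?_ (by simp)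
    rintro _ ⟨⟨x, hx, rfl⟩, ⟨y, hy, hxy⟩⟩
    have := ha' hx
    have := hb' hy
    simp only [Set.mem_singleton_iff] at *
    linarith
  rw [← h1, ← h2, ← measure_union₀ _ hd]
  · refine measure_mono (Set.union_subset ?_ ?_)
    · rintro _ ⟨x, hx, rfl⟩; exact h x hx b hb
    · rintro _ ⟨x, hx, rfl⟩; exact h a ha x hx
  · exact (hB.image (by fun_prop)).measurableSet.nullMeasurableSet

/-- One-dimensional Brunn–Minkowski inequality. -/
theorem volume_add_volume_le {A B S : Set ℝ} (hA : MeasurableSet A) (hB : MeasurableSet B)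
    (hA₀ : A.Nonempty) (hB₀ : B.Nonempty) (h : ∀ a ∈ A, ∀ b ∈ B, a + b ∈ S) :
    volume A + volume B ≤ volume S := by
  obtain ⟨a, ha⟩ := hA₀
  obtain ⟨b, hb⟩ := hB₀
  rw [hA.measure_eq_iSup_isCompact, hB.measure_eq_iSup_isCompact]
  simp only [iSup_and']
  refine ENNReal.biSup_add_biSup_le' ⟨∅, by simp⟩ ⟨∅, by simp⟩ fun A' hA' B' hB' => ?_
  -- The inner compact sets may be empty; inserting a point makes the compact case applicable.
  calc volume A' + volume B' ≤ volume (insert a A') + volume (insert b B') := by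
        gcongr <;> exact Set.subset_insert _ _
    _ ≤ volume S := by
        refine volume_add_volume_le_of_isCompact (hA'.2.insert a) (hB'.2.insert b)
          (Set.insert_nonempty _ _) (Set.insert_nonempty _ _) fun x hx y hy => h x ?_ y ?_
        · exact Set.insert_subset ha hA'.1 hx
        · exact Set.insert_subset hb hB'.1 hy

open scoped Pointwise in
/-- Prékopa's inequality on the line for functions with supremum `1`. -/
theorem lintegral_add_lintegral_le_of_iSup_eq_one {φ ψ h : ℝ → ℝ} (hφ : Measurable φ)
    (hψ : Measurable ψ) (hh : Measurable h) (hφ₀ : ∀ x, 0 ≤ φ x) (hψ₀ : ∀ x, 0 ≤ ψ x)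
    (hh₀ : ∀ x, 0 ≤ h x) (hφ₁ : ∀ x, φ x ≤ 1) (hψ₁ : ∀ x, ψ x ≤ 1)
    (hφs : ∀ t < 1, ∃ x, t < φ x) (hψs : ∀ t < 1, ∃ x, t < ψ x)
    (H : ∀ a b, φ a * ψ b ≤ h ((a + b) / 2) ^ 2) :
    (∫⁻ x, ENNReal.ofReal (φ x)) + ∫⁻ x, ENNReal.ofReal (ψ x) ≤
      2 * ∫⁻ x, ENNReal.ofReal (h x) := by
  rw [lintegral_eq_lintegral_meas_lt _ (.of_forall hφ₀) hφ.aemeasurable,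
    lintegral_eq_lintegral_meas_lt _ (.of_forall hψ₀) hψ.aemeasurable,
    lintegral_eq_lintegral_meas_lt _ (.of_forall hh₀) hh.aemeasurable,
    ← lintegral_const_mul' _ _ (by simp), ← lintegral_add_left]
  · refine setLIntegral_mono' measurableSet_Ioi fun t (ht : 0 < t) => ?_
    rcases lt_or_ge t 1 with h1 | h1
    · have h2 : (2 : ℝ≥0∞) * volume {a | t < h a} = volume ((fun x => 2 * x) '' {a | t < h a}) := by
        rw [show (fun x => 2 * x) '' {a | t < h a} = (2 : ℝ) • {a | t < h a} from rfl,
          Measure.addHaar_smul]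
        simp
      rw [h2]
      -- Superlevel sets satisfy `{φ > t} + {ψ > t} ⊆ 2 {h > t}`; the normalization of the suprema
      -- makes both summands nonempty for every `t < 1`.
      refine volume_add_volume_le (hφ measurableSet_Ioi) (hψ measurableSet_Ioi) (hφs t h1)
        (hψs t h1) fun a ha b hb => ⟨(a + b) / 2, ?_, by ring⟩
      have ha : t < φ a := ha
      have hb : t < ψ b := hb
      show t < _
      refine lt_of_pow_lt_pow_left₀ 2 (hh₀ _) (lt_of_lt_of_le ?_ (H a b))
      nlinarith
    · have e1 : {a | t < φ a} = ∅ := by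
        ext x; simpa using (hφ₁ x).trans h1
      have e2 : {a | t < ψ a} = ∅ := by
        ext x; simpa using (hψ₁ x).trans h1
      simp [e1, e2]
  · exact Antitone.measurable fun s t hst => measure_mono fun a (ha : t < φ a) => hst.trans_lt ha

theorem ENNReal.four_mul_le_add_sq (a b : ℝ≥0∞) : 4 * (a * b) ≤ (a + b) ^ 2 := by
  rcases eq_or_ne a ∞ with rfl | ha
  · simp
  rcases eq_or_ne b ∞ with rfl | hb
  · simp
  lift a to NNReal using ha
  lift b to NNReal using hb
  norm_cast
  rw [← NNReal.coe_le_coe]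
  push_cast
  nlinarith [sq_nonneg ((a : ℝ) - b)]

/-- Prékopa's inequality on the line, for a bounded majorant. -/
theorem lintegral_mul_lintegral_le_sq {φ ψ : ℝ → ℝ≥0∞} {h : ℝ → ℝ} {C : ℝ} (hφ : Measurable φ)
    (hψ : Measurable ψ) (hh : Measurable h) (hh₀ : ∀ x, 0 ≤ h x) (hC : ∀ x, h x ≤ C)
    (H : ∀ a b, φ a * ψ b ≤ ENNReal.ofReal (h ((a + b) / 2) ^ 2)) :
    (∫⁻ x, φ x) * ∫⁻ x, ψ x ≤ (∫⁻ x, ENNReal.ofReal (h x)) ^ 2 := by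
  set S := ⨆ x, φ x
  set T := ⨆ x, ψ x
  -- Boundedness of `h` serves only to make both suprema finite, so that one can divide by them.
  have hST : S * T ≤ ENNReal.ofReal (C ^ 2) := by
    simp only [S, T, ENNReal.iSup_mul, ENNReal.mul_iSup, iSup_le_iff]
    intro a b
    refine (H _ _).trans (ENNReal.ofReal_le_ofReal ?_)
    have := hh₀ ((b + a) / 2)
    gcongr
    all_goals first | apply hh₀ | apply hC
  rcases eq_or_ne S 0 with hS | hS
  · have : ∀ x, φ x = 0 := by simpa [S] using hS
    simp [this]
  rcases eq_or_ne T 0 with hT | hT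
  · have : ∀ x, ψ x = 0 := by simpa [T] using hT
    simp [this]
  have hS' : S ≠ ⊤ := by
    intro h'; rw [h', ENNReal.top_mul hT] at hST; simp at hST
  have hT' : T ≠ ⊤ := by
    intro h'; rw [h', ENNReal.mul_top hS] at hST; simp at hST
  have hφt : ∀ x, φ x ≠ ⊤ := fun x => ne_top_of_le_ne_top hS' (le_iSup φ x)
  have hψt : ∀ x, ψ x ≠ ⊤ := fun x => ne_top_of_le_ne_top hT' (le_iSup ψ x)
  have hs : 0 < S.toReal := ENNReal.toReal_pos hS hS'
  have ht : 0 < T.toReal := ENNReal.toReal_pos hT hT'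
  have sup_aux : ∀ {χ : ℝ → ℝ≥0∞}, ⨆ x, χ x ≠ 0 → ⨆ x, χ x ≠ ⊤ →
      ∀ t < (1 : ℝ), ∃ x, t < (χ x).toReal / (⨆ x, χ x).toReal := by
    intro χ h0 h1 t ht
    have hp := ENNReal.toReal_pos h0 h1
    have : ENNReal.ofReal (t * (⨆ x, χ x).toReal) < ⨆ x, χ x := by
      refine ((ENNReal.ofReal_lt_ofReal_iff hp).2 ?_).trans_eq (ENNReal.ofReal_toReal h1)
      nlinarith
    obtain ⟨x, hx⟩ := lt_iSup_iff.1 this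
    refine ⟨x, (lt_div_iff₀ hp).2 ?_⟩
    rw [← ENNReal.ofReal_toReal (ne_top_of_le_ne_top h1 (le_iSup χ x)),
      ENNReal.ofReal_lt_ofReal_iff'] at hx
    exact hx.1
  have key := lintegral_add_lintegral_le_of_iSup_eq_one (φ := fun x => (φ x).toReal / S.toReal)
    (ψ := fun x => (ψ x).toReal / T.toReal) (h := fun x => h x / √(S.toReal * T.toReal))
    (by fun_prop) (by fun_prop) (by fun_prop) (fun _ => by positivity) (fun _ => by positivity)
    (fun x => div_nonneg (hh₀ x) (by positivity))
    (fun x => (div_le_one hs).2 (ENNReal.toReal_mono hS' (le_iSup φ x)))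
    (fun x => (div_le_one ht).2 (ENNReal.toReal_mono hT' (le_iSup ψ x)))
    (sup_aux hS hS') (sup_aux hT hT') (fun a b => ?_)
  · have e : ∀ (χ : ℝ → ℝ≥0∞) {R : ℝ}, (∀ x, χ x ≠ ⊤) → 0 < R →
        ∫⁻ x, ENNReal.ofReal ((χ x).toReal / R) = (∫⁻ x, χ x) / ENNReal.ofReal R := by
      intro χ R hχ hR
      simp_rw [ENNReal.ofReal_div_of_pos hR, ENNReal.ofReal_toReal (hχ _), div_eq_mul_inv]
      rw [lintegral_mul_const' _ _
        (by simpa only [ne_eq, ENNReal.inv_eq_top, ENNReal.ofReal_eq_zero, not_le] using hR)]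
    have hR : 0 < √(S.toReal * T.toReal) := by positivity
    have e3 : ∫⁻ x, ENNReal.ofReal (h x / √(S.toReal * T.toReal)) =
        (∫⁻ x, ENNReal.ofReal (h x)) / ENNReal.ofReal √(S.toReal * T.toReal) := by
      simp_rw [ENNReal.ofReal_div_of_pos hR, div_eq_mul_inv]
      rw [lintegral_mul_const' _ _
        (by simpa only [ne_eq, ENNReal.inv_eq_top, ENNReal.ofReal_eq_zero, not_le] using hR)]
    rw [e φ hφt hs, e ψ hψt ht, e3, ENNReal.ofReal_toReal hS', ENNReal.ofReal_toReal hT'] at key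
    -- The additive inequality for the normalized functions becomes multiplicative by AM-GM, and the
    -- factors `S * T` cancel.
    have k2 := (ENNReal.four_mul_le_add_sq _ _).trans (pow_le_pow_left₀ (zero_le) key 2)
    have k3 : (ENNReal.ofReal √(S.toReal * T.toReal)) ^ 2 = S * T := by
      rw [← ENNReal.ofReal_pow (by positivity), Real.sq_sqrt (by positivity),
        ENNReal.ofReal_mul (by positivity), ENNReal.ofReal_toReal hS', ENNReal.ofReal_toReal hT']
    have k4 : ∀ X Y : ℝ≥0∞, 4 * (X / S * (Y / T)) = 4 * (X * Y / (S * T)) := by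
      intro X Y
      rw [div_eq_mul_inv, div_eq_mul_inv, div_eq_mul_inv, ENNReal.mul_inv (.inl hS) (.inl hS')]
      ring
    have k5 : ∀ X Y : ℝ≥0∞, (2 * (X / Y)) ^ 2 = 4 * (X ^ 2 / Y ^ 2) := by
      intro X Y
      rw [div_eq_mul_inv, div_eq_mul_inv, mul_pow, mul_pow, ENNReal.inv_pow]
      norm_num
    rw [k4, k5, k3, ENNReal.mul_le_mul_iff_right (by simp) (by simp),
      ENNReal.div_le_iff (mul_ne_zero hS hT) (ENNReal.mul_ne_top hS' hT'),
      ENNReal.div_mul_cancel (mul_ne_zero hS hT) (ENNReal.mul_ne_top hS' hT')] at k2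
    exact k2
  · have := ENNReal.toReal_mono (by simp) (H a b)
    rw [ENNReal.toReal_mul, ENNReal.toReal_ofReal (by positivity)] at this
    rw [div_mul_div_comm, div_pow, Real.sq_sqrt (by positivity)]
    gcongr

/-- A multiplicative Prékopa inequality on the half-line. -/
theorem lintegral_Ioi_mul_lintegral_Ioi_le {φ ψ : ℝ → ℝ≥0∞} {c : ℝ} (hφ : Measurable φ)
    (hψ : Measurable ψ) (hc : 0 ≤ c)
    (H : ∀ r > 0, ∀ s > 0, φ r * ψ s ≤ ENNReal.ofReal (c * Real.exp (-(r * s)))) :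
    (∫⁻ r in Set.Ioi 0, φ r) * ∫⁻ s in Set.Ioi 0, ψ s ≤ ENNReal.ofReal (c * (Real.pi / 2)) := by
  have sub : ∀ χ : ℝ → ℝ≥0∞, ∫⁻ r in Set.Ioi 0, χ r =
      ∫⁻ a, ENNReal.ofReal (Real.exp a) * χ (Real.exp a) := by
    intro χ
    have := lintegral_image_eq_lintegral_abs_deriv_mul MeasurableSet.univ
      (fun x _ => (Real.hasDerivAt_exp x).hasDerivWithinAt) Real.exp_injective.injOn χ
    simpa [Real.range_exp, abs_of_pos (Real.exp_pos _)] using this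
  -- In the variables `r = exp a`, `s = exp b`, the product `r s` depends only on the midpoint of
  -- `a` and `b`. The majorant is a half-line Gaussian, whose squared integral is `c π / 2`.
  have main := lintegral_mul_lintegral_le_sq
    (φ := fun a => ENNReal.ofReal (Real.exp a) * φ (Real.exp a))
    (ψ := fun a => ENNReal.ofReal (Real.exp a) * ψ (Real.exp a))
    (h := fun u => √c * (Real.exp u * Real.exp (-(1 / 2) * Real.exp u ^ 2))) (C := √c)
    (by fun_prop) (by fun_prop) (by fun_prop) (fun _ => by positivity) ?_ ?_
  · rw [← sub, ← sub] at main
    refine main.trans (le_of_eq ?_)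
    have g : ∫⁻ a, ENNReal.ofReal (√c * (Real.exp a * Real.exp (-(1 / 2) * Real.exp a ^ 2))) =
        ENNReal.ofReal (√c * (√(Real.pi / (1 / 2)) / 2)) := by
      simp_rw [ENNReal.ofReal_mul (Real.sqrt_nonneg c)]
      rw [lintegral_const_mul' _ _ (by simp)]
      congr 1
      simp_rw [ENNReal.ofReal_mul (Real.exp_pos _).le]
      rw [← sub (fun r => ENNReal.ofReal (Real.exp (-(1 / 2) * r ^ 2))),
        ← ofReal_integral_eq_lintegral_ofReal, integral_gaussian_Ioi]
      · exact (integrable_exp_neg_mul_sq (by norm_num)).integrableOn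
      · exact .of_forall fun _ => (Real.exp_pos _).le
    rw [g, ← ENNReal.ofReal_pow (by positivity), mul_pow, Real.sq_sqrt hc, div_pow,
      Real.sq_sqrt (by positivity)]
    congr 1
    ring
  · intro u
    refine mul_le_of_le_one_right (Real.sqrt_nonneg _) ?_
    rw [← Real.exp_add, Real.exp_le_one_iff]
    nlinarith [Real.add_one_le_exp u, sq_nonneg (Real.exp u - 1)]
  · intro a b
    have := H _ (Real.exp_pos a) _ (Real.exp_pos b)
    calc _ = ENNReal.ofReal (Real.exp a) * ENNReal.ofReal (Real.exp b) *
          (φ (Real.exp a) * ψ (Real.exp b)) := by ring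
      _ ≤ ENNReal.ofReal (Real.exp a) * ENNReal.ofReal (Real.exp b) *
          ENNReal.ofReal (c * Real.exp (-(Real.exp a * Real.exp b))) := by gcongr
      _ = _ := by
          rw [← ENNReal.ofReal_mul (by positivity), ← ENNReal.ofReal_mul (by positivity)]
          congr 1
          rw [mul_pow, Real.sq_sqrt hc, mul_pow]
          simp only [← Real.exp_add, ← Real.exp_nat_mul, mul_left_comm _ c]
          congr 2
          push_cast
          ring_nf

/-! ### The functional Santaló inequality, by induction on the dimension. -/

open scoped Matrix

/-- The functional Santaló inequality in dimension `n`. The centering hypothesis on `f` holds as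
soon as `f` has its barycenter at the origin. -/
def FunctionalSantalo (n : ℕ) : Prop :=
  ∀ f g : (Fin n → ℝ) → ℝ≥0∞, Measurable f → Measurable g →
    (∀ z, ∫⁻ x, f x ≤ ∫⁻ x, f x * ENNReal.ofReal (Real.exp (x ⬝ᵥ z))) →
    (∀ x y, f x * g y ≤ ENNReal.ofReal (Real.exp (-(x ⬝ᵥ y)))) →
    (∫⁻ x, f x) * ∫⁻ y, g y ≤ ENNReal.ofReal ((2 * Real.pi) ^ n)

theorem functionalSantalo_zero : FunctionalSantalo 0 := by
  intro f g _ _ _ h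
  simpa [Measure.volume_pi_eq_dirac (0 : Fin 0 → ℝ)] using h 0 0

variable {n : ℕ}

theorem setLIntegral_Ioi_prod_univ {A : ℝ × (Fin n → ℝ) → ℝ≥0∞} (hA : Measurable A) :
    ∫⁻ p in Set.Ioi 0 ×ˢ Set.univ, A p = ∫⁻ y, ∫⁻ s in Set.Ioi 0, A (s, y) := by
  rw [Measure.volume_eq_prod, ← Measure.prod_restrict, Measure.restrict_univ,
    lintegral_prod_symm _ hA.aemeasurable]

/-- The functional Santaló inequality on a half-space. -/
theorem FunctionalSantalo.halfSpace (hn : FunctionalSantalo n) {A B : ℝ × (Fin n → ℝ) → ℝ≥0∞}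
    (hA : Measurable A) (hB : Measurable B)
    (hJ : ∀ z, ∫⁻ p in Set.Ioi 0 ×ˢ Set.univ, A p ≤
      ∫⁻ p in Set.Ioi 0 ×ˢ Set.univ, A p * ENNReal.ofReal (Real.exp (p.2 ⬝ᵥ z)))
    (hAB : ∀ p q : ℝ × (Fin n → ℝ), 0 < p.1 → 0 < q.1 →
      A p * B q ≤ ENNReal.ofReal (Real.exp (-(p.1 * q.1 + p.2 ⬝ᵥ q.2)))) :
    (∫⁻ p in Set.Ioi 0 ×ˢ Set.univ, A p) * ∫⁻ q in Set.Ioi 0 ×ˢ Set.univ, B q ≤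
      ENNReal.ofReal ((2 * Real.pi) ^ n * (Real.pi / 2)) := by
  have hpi : (0 : ℝ) < Real.pi / 2 := by positivity
  rw [setLIntegral_Ioi_prod_univ hA, setLIntegral_Ioi_prod_univ hB]
  -- The fiber integrals over vertical half-lines are dual in the sense of the `n`-dimensional
  -- inequality, up to the factor `π / 2` absorbed into the second one.
  have key := hn (fun y => ∫⁻ s in Set.Ioi 0, A (s, y))
    (fun x => (∫⁻ r in Set.Ioi 0, B (r, x)) / ENNReal.ofReal (Real.pi / 2))
    hA.lintegral_prod_left' (hB.lintegral_prod_left'.div_const _) (fun z => ?_) (fun y x => ?_)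
  · simp_rw [div_eq_mul_inv] at key
    rw [lintegral_mul_const' _ _ (by simpa using Real.pi_pos), ← mul_assoc, ← div_eq_mul_inv,
      ENNReal.div_le_iff (by simpa using Real.pi_pos) (by simp)] at key
    rwa [ENNReal.ofReal_mul (by positivity)]
  · have := hJ z
    rw [setLIntegral_Ioi_prod_univ hA, setLIntegral_Ioi_prod_univ (by fun_prop)] at this
    refine this.trans_eq (lintegral_congr fun y => ?_)
    exact lintegral_mul_const' (ENNReal.ofReal (Real.exp (y ⬝ᵥ z))) _ ENNReal.ofReal_ne_top
  · rw [← mul_div_assoc]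
    refine ENNReal.div_le_of_le_mul ?_
    rw [← ENNReal.ofReal_mul (by positivity)]
    refine lintegral_Ioi_mul_lintegral_Ioi_le (by fun_prop) (by fun_prop) (by positivity) ?_
    intro s hs r hr
    refine (hAB (s, y) (r, x) hs hr).trans_eq ?_
    rw [← Real.exp_add]
    congr 2
    simp only
    ring

/-- Integrate `1 + φ ≤ exp φ`. This converts a vanishing barycenter into the exponential centering
hypothesis. -/
theorem measure_univ_le_lintegral_exp {α : Type*} [MeasurableSpace α] {μ : Measure α}
    [IsFiniteMeasure μ] {φ : α → ℝ} (hφ : Integrable φ μ) (h0 : ∫ x, φ x ∂μ = 0) :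
    μ Set.univ ≤ ∫⁻ x, ENNReal.ofReal (Real.exp (φ x)) ∂μ := by
  have h1 : ∫ x, (φ x + 1) ∂μ = μ.real Set.univ := by
    rw [integral_add hφ (integrable_const _), h0]; simp
  calc μ Set.univ = ENNReal.ofReal (∫ x, (φ x + 1) ∂μ) := by rw [h1]; simp
    _ ≤ ∫⁻ x, ENNReal.ofReal (φ x + 1) ∂μ := by
        have e : ∀ x, ENNReal.ofReal (φ x + 1) = ENNReal.ofReal (max (φ x + 1) 0) := by simp
        have hi : Integrable (fun x => φ x + 1) μ := hφ.add (integrable_const _)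
        simp_rw [e]
        rw [← ofReal_integral_eq_lintegral_ofReal hi.pos_part (.of_forall fun _ => le_max_right _ _)]
        exact ENNReal.ofReal_le_ofReal (integral_mono hi hi.pos_part fun _ => le_max_left _ _)
    _ ≤ _ := lintegral_mono fun x => ENNReal.ofReal_le_ofReal (Real.add_one_le_exp _)

/-- Without atoms the distribution function is continuous, so the intermediate value theorem
applies. -/
theorem exists_measure_Iic_eq_half (ν : Measure ℝ) [IsFiniteMeasure ν] [NullSingletonClass ν] :
    ∃ t, ν (Set.Iic t) = ν Set.univ / 2 := by
  have hc : Continuous fun t => ν.real (Set.Iic t) := by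
    have h := intervalIntegral.continuous_primitive (μ := ν) (f := fun _ => (1 : ℝ))
      (fun a b => intervalIntegrable_const) 0
    have e : (fun t => ν.real (Set.Iic t)) =
        fun t => (∫ x in (0 : ℝ)..t, (1 : ℝ) ∂ν) + ν.real (Set.Iic 0) := by
      ext t
      rw [← intervalIntegral.integral_Iic_sub_Iic (integrable_const _).integrableOn
        (integrable_const _).integrableOn]
      simp
    rw [e]; fun_prop
  have htop : Filter.Tendsto (fun t => ν.real (Set.Iic t)) .atTop (𝓝 (ν.real Set.univ)) :=
    (ENNReal.tendsto_toReal (measure_ne_top _ _)).comp (tendsto_measure_Iic_atTop ν)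
  have hbot : Filter.Tendsto (fun t => ν.real (Set.Ici t)) .atBot (𝓝 (ν.real Set.univ)) :=
    (ENNReal.tendsto_toReal (measure_ne_top _ _)).comp (tendsto_measure_Ici_atBot ν)
  rcases eq_or_ne ν 0 with rfl | hν
  · exact ⟨0, by simp⟩
  have hpos : 0 < ν.real Set.univ := by
    rw [measureReal_def]; exact ENNReal.toReal_pos (by simpa using hν) (measure_ne_top _ _)
  obtain ⟨a, ha⟩ := (hbot.eventually (lt_mem_nhds (half_lt_self hpos))).exists
  have ha' : ν.real (Set.Iic a) = ν.real Set.univ - ν.real (Set.Ici a) := by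
    rw [← measureReal_compl measurableSet_Ici, Set.compl_Ici, measureReal_def, measureReal_def,
      Iio_ae_eq_Iic.measure_eq]
  obtain ⟨b, hb⟩ := (htop.eventually (lt_mem_nhds (half_lt_self hpos))).exists
  obtain ⟨t, ht⟩ := mem_range_of_exists_le_of_exists_ge hc ⟨a, by linarith⟩ ⟨b, hb.le⟩
  refine ⟨t, ?_⟩
  rw [← ENNReal.toReal_eq_toReal_iff' (measure_ne_top _ _) (by finiteness), ENNReal.toReal_div]
  simpa [measureReal_def] using ht

/-- A finite measure charging no vertical hyperplane is halved by a hyperplane `y₁ = t`, and after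
a shear both halves have their barycenters above the same point of that hyperplane. -/
theorem exists_halving (μ : Measure (ℝ × (Fin n → ℝ))) [IsFiniteMeasure μ] (hμ : μ ≠ 0)
    (hint : Integrable (fun y => y) μ) (h0 : ∀ t : ℝ, μ {y | y.1 = t} = 0) :
    ∃ (t : ℝ) (w c : Fin n → ℝ),
      (μ {y | t < y.1} = μ Set.univ / 2 ∧ μ {y | y.1 < t} = μ Set.univ / 2) ∧
      ∫ y in {y | t < y.1}, (y.2 - c - (y.1 - t) • w) ∂μ = 0 ∧
      ∫ y in {y | y.1 < t}, (y.2 - c - (y.1 - t) • w) ∂μ = 0 := by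
  have : NullSingletonClass (μ.map Prod.fst) := ⟨fun t => by
    rw [Measure.map_apply measurable_fst (measurableSet_singleton t)]; exact h0 t⟩
  obtain ⟨t, ht⟩ := exists_measure_Iic_eq_half (μ.map Prod.fst)
  rw [Measure.map_apply measurable_fst measurableSet_Iic,
    Measure.map_apply measurable_fst MeasurableSet.univ, Set.preimage_univ] at ht
  have hlt : μ {y | y.1 < t} = μ Set.univ / 2 := by
    rw [← ht]
    refine le_antisymm (measure_mono fun y (hy : y.1 < t) => hy.le) ?_
    calc μ (Prod.fst ⁻¹' Set.Iic t) ≤ μ ({y | y.1 < t} ∪ {y | y.1 = t}) :=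
          measure_mono fun y (hy : y.1 ≤ t) => lt_or_eq_of_le hy
      _ ≤ μ {y | y.1 < t} + μ {y | y.1 = t} := measure_union_le _ _
      _ = _ := by rw [h0, add_zero]
  have hgt : μ {y | t < y.1} = μ Set.univ / 2 := by
    have e : {y : ℝ × (Fin n → ℝ) | t < y.1} = (Prod.fst ⁻¹' Set.Iic t)ᶜ := by
      ext y; simp
    rw [e, measure_compl (measurable_fst measurableSet_Iic) (measure_ne_top _ _), ht,
      ENNReal.sub_half (measure_ne_top _ _)]
  have hpos : 0 < μ.real Set.univ := by
    rw [measureReal_def]; exact ENNReal.toReal_pos (by simpa using hμ) (measure_ne_top _ _)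
  have i1 : Integrable (fun y : ℝ × (Fin n → ℝ) => y.1) μ := hint.fst
  have i2 : Integrable (fun y : ℝ × (Fin n → ℝ) => y.2) μ := hint.snd
  have i3 : Integrable (fun y : ℝ × (Fin n → ℝ) => y.1 - t) μ := i1.sub (integrable_const _)
  set P := {y : ℝ × (Fin n → ℝ) | t < y.1}
  set Q := {y : ℝ × (Fin n → ℝ) | y.1 < t}
  have hPm : MeasurableSet P := measurable_fst measurableSet_Ioi
  have hQm : MeasurableSet Q := measurable_fst measurableSet_Iio
  set α := ∫ y in P, (y.1 - t) ∂μ with hα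
  set β := ∫ y in Q, (y.1 - t) ∂μ with hβ
  set M := μ.real Set.univ / 2
  have hαpos : 0 < α := by
    refine (setIntegral_pos_iff_support_of_nonneg_ae ?_ i3.integrableOn).2 ?_
    · exact (ae_restrict_iff' hPm).2 (.of_forall fun y (hy : t < y.1) => (sub_pos.2 hy).le)
    · have : P ⊆ Function.support fun y : ℝ × (Fin n → ℝ) => y.1 - t :=
        fun y (hy : t < y.1) => (sub_pos.2 hy).ne'
      rw [Set.inter_eq_self_of_subset_right this, hgt]
      simpa using hμ
  have hβneg : 0 < -β := by
    rw [hβ, ← integral_neg]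
    refine (setIntegral_pos_iff_support_of_nonneg_ae ?_ i3.neg.integrableOn).2 ?_
    · exact (ae_restrict_iff' hQm).2 (.of_forall fun y (hy : y.1 < t) => by simpa using hy.le)
    · have : Q ⊆ Function.support (-fun y : ℝ × (Fin n → ℝ) => y.1 - t) :=
        fun y (hy : y.1 < t) => (neg_pos.2 (sub_neg.2 hy)).ne'
      rw [Set.inter_eq_self_of_subset_right this, hlt]
      simpa using hμ
  have comp : ∀ (S : Set (ℝ × (Fin n → ℝ))) (w c : Fin n → ℝ), μ S = μ Set.univ / 2 →
      ∫ y in S, (y.2 - c - (y.1 - t) • w) ∂μ =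
        ∫ y in S, y.2 ∂μ - M • c - (∫ y in S, (y.1 - t) ∂μ) • w := by
    intro S w c hS
    rw [integral_sub, integral_sub, integral_smul_const, setIntegral_const, measureReal_def, hS,
      ENNReal.toReal_div]
    · rfl
    · exact i2.integrableOn
    · exact integrable_const _
    · exact i2.integrableOn.sub (integrable_const _)
    · exact i3.integrableOn.smul_const _
  set bP := ∫ y in P, y.2 ∂μ
  set bQ := ∫ y in Q, y.2 ∂μ
  have hM : M ≠ 0 := by positivity
  have hαβ : α - β ≠ 0 := by linarith
  -- The solution of the linear system `bP = M c + α w`, `bQ = M c + β w`, which is solvable because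
  -- `β < 0 < α`.
  refine ⟨t, (α - β)⁻¹ • (bP - bQ), M⁻¹ • (bP - α • (α - β)⁻¹ • (bP - bQ)), ⟨hgt, hlt⟩, ?_, ?_⟩
  · rw [comp P _ _ hgt, smul_inv_smul₀ hM]
    abel
  · rw [comp Q _ _ hlt, smul_inv_smul₀ hM]
    have : (bP - bQ) = (α - β) • (α - β)⁻¹ • (bP - bQ) := by rw [smul_inv_smul₀ hαβ]
    generalize (α - β)⁻¹ • (bP - bQ) = v at *
    rw [sub_smul] at this
    linear_combination (exp := 1) -this

theorem measurePreserving_const_add_mul {ε : ℝ} (hε : ε * ε = 1) (t : ℝ) :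
    MeasurePreserving (fun s : ℝ => t + ε * s) := by
  refine ⟨by fun_prop, ?_⟩
  have h1 : |ε⁻¹| = 1 := by
    rcases mul_self_eq_one_iff.1 hε with rfl | rfl <;> norm_num
  have h0 : ε ≠ 0 := by rintro rfl; simp at hε
  have : (fun s : ℝ => t + ε * s) = (fun s => t + s) ∘ fun s => ε * s := rfl
  rw [this, ← Measure.map_map (by fun_prop) (by fun_prop), Real.map_volume_mul_left h0, h1]
  simp [map_add_left_eq_self]

/-- Parametrizes the half-space on the `ε`-side of `y₁ = t` by `p₁ > 0`;
`measurePreserving_shear_fst` is the dual change of variables for `f`. -/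
theorem measurePreserving_shear {ε : ℝ} (hε : ε * ε = 1) (t : ℝ) (w c : Fin n → ℝ) :
    MeasurePreserving
      (fun p : ℝ × (Fin n → ℝ) => (t + ε * p.1, (c + (ε * p.1) • w) + p.2)) := by
  refine (measurePreserving_const_add_mul hε t).skew_product (g := fun s y => (c + (ε * s) • w) + y)
    (by fun_prop) (.of_forall fun s => ?_)
  exact map_add_left_eq_self _ _

theorem measurePreserving_shear_fst {ε : ℝ} (hε : ε * ε = 1) (w : Fin n → ℝ) :
    MeasurePreserving (fun p : ℝ × (Fin n → ℝ) => (-(p.2 ⬝ᵥ w) + ε * p.1, p.2)) := by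
  have h := (MeasurePreserving.id (volume : Measure (Fin n → ℝ))).skew_product
    (μc := (volume : Measure ℝ)) (μd := volume) (g := fun x s => -(x ⬝ᵥ w) + ε * s)
    (by fun_prop) (.of_forall fun x => (measurePreserving_const_add_mul hε _).map_eq)
  exact (Measure.measurePreserving_swap.comp h).comp Measure.measurePreserving_swap

/-- The inductive step for functions on `ℝ × ℝⁿ`, when `g` has a finite first moment. -/
theorem FunctionalSantalo.prod_of_integrable (hn : FunctionalSantalo n) {f g : ℝ × (Fin n → ℝ) → ℝ≥0∞}
    (hf : Measurable f) (hg : Measurable g) (hgf : ∫⁻ y, g y ≠ ⊤)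
    (hgi : Integrable (fun y => y) (volume.withDensity g))
    (hJ : ∀ z : ℝ × (Fin n → ℝ), ∫⁻ x, f x ≤
      ∫⁻ x, f x * ENNReal.ofReal (Real.exp (x.1 * z.1 + x.2 ⬝ᵥ z.2)))
    (hfg : ∀ x y, f x * g y ≤ ENNReal.ofReal (Real.exp (-(x.1 * y.1 + x.2 ⬝ᵥ y.2)))) :
    (∫⁻ x, f x) * ∫⁻ y, g y ≤ ENNReal.ofReal ((2 * Real.pi) ^ (n + 1)) := by
  rcases eq_or_ne (∫⁻ y, g y) 0 with hg0 | hg0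
  · simp [hg0]
  set μ := (volume : Measure (ℝ × (Fin n → ℝ))).withDensity g with hμ
  have hμu : μ Set.univ = ∫⁻ y, g y := by simp [hμ]
  have : IsFiniteMeasure μ := ⟨by rw [hμu]; exact hgf.lt_top⟩
  have hvol0 : ∀ t : ℝ, volume {y : ℝ × (Fin n → ℝ) | y.1 = t} = 0 := fun t => by
    have : {y : ℝ × (Fin n → ℝ) | y.1 = t} = {t} ×ˢ Set.univ := by ext; simp
    rw [this, Measure.volume_eq_prod, Measure.prod_prod]; simp
  obtain ⟨t, w, c, ⟨hP, hQ⟩, hP0, hQ0⟩ := exists_halving μ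
    (by rw [ne_eq, ← Measure.measure_univ_eq_zero, hμu]; exact hg0) hgi
    (fun t => withDensity_absolutelyContinuous _ _ (hvol0 t))
  -- The exponential tilt of `f` compensates for moving the origin of the `y` variable to `(t, c)`.
  set F : ℝ × (Fin n → ℝ) → ℝ≥0∞ :=
    fun x => f x * ENNReal.ofReal (Real.exp (x.1 * t + x.2 ⬝ᵥ c)) with hF
  have hFm : Measurable F := by fun_prop
  have key : ∀ ε : ℝ, ε * ε = 1 → μ {y | 0 < ε * (y.1 - t)} = μ Set.univ / 2 →
      ∫ y in {y | 0 < ε * (y.1 - t)}, (y.2 - c - (y.1 - t) • w) ∂μ = 0 →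
      (∫⁻ y, g y) / 2 * ∫⁻ x in {x | 0 < ε * (x.1 + x.2 ⬝ᵥ w)}, F x ≤
        ENNReal.ofReal ((2 * Real.pi) ^ n * (Real.pi / 2)) := by
    -- `ε = 1` and `ε = -1` treat the two halves. The dual maps `T` and `U` satisfy `⟨U q, T p⟩ =
    -- ⟨q, p⟩ + ⟨U q, (t, c)⟩`, and the last term cancels against the tilt in `F`.
    intro ε hε hS hS0
    set T := fun p : ℝ × (Fin n → ℝ) => (t + ε * p.1, (c + (ε * p.1) • w) + p.2) with hT
    set U := fun p : ℝ × (Fin n → ℝ) => (-(p.2 ⬝ᵥ w) + ε * p.1, p.2) with hU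
    have mT : MeasurePreserving T := measurePreserving_shear hε t w c
    have mU : MeasurePreserving U := measurePreserving_shear_fst hε w
    have sm : MeasurableSet {y : ℝ × (Fin n → ℝ) | 0 < ε * (y.1 - t)} :=
      measurableSet_lt (by fun_prop) (by fun_prop)
    have sm' : MeasurableSet {x : ℝ × (Fin n → ℝ) | 0 < ε * (x.1 + x.2 ⬝ᵥ w)} :=
      measurableSet_lt (by fun_prop) (by fun_prop)
    have pT : T ⁻¹' {y | 0 < ε * (y.1 - t)} = Set.Ioi 0 ×ˢ Set.univ := by
      ext p; simp [hT, ← mul_assoc, hε]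
    have pU : U ⁻¹' {x | 0 < ε * (x.1 + x.2 ⬝ᵥ w)} = Set.Ioi 0 ×ˢ Set.univ := by
      ext p; simp [hU, ← mul_assoc, hε]
    have iT : ∀ χ : ℝ × (Fin n → ℝ) → ℝ≥0∞, Measurable χ →
        ∫⁻ p in Set.Ioi 0 ×ˢ Set.univ, χ (T p) = ∫⁻ y in {y | 0 < ε * (y.1 - t)}, χ y := by
      intro χ hχ
      rw [← pT, mT.setLIntegral_comp_preimage sm hχ]
    have iU : ∫⁻ p in Set.Ioi 0 ×ˢ Set.univ, F (U p) =
        ∫⁻ x in {x | 0 < ε * (x.1 + x.2 ⬝ᵥ w)}, F x := by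
      rw [← pU, mU.setLIntegral_comp_preimage sm' hFm]
    have gS : ∫⁻ y in {y | 0 < ε * (y.1 - t)}, g y = (∫⁻ y, g y) / 2 := by
      rw [← hμu, ← hS, hμ, withDensity_apply _ sm]
    rw [← gS, ← iU, ← iT g hg]
    refine hn.halfSpace (hg.comp mT.measurable) (hFm.comp mU.measurable) (fun z => ?_) ?_
    · have e1 := iT (fun y => g y * ENNReal.ofReal (Real.exp ((y.2 - c - (y.1 - t) • w) ⬝ᵥ z)))
        (by fun_prop)
      have e2 : ∀ p : ℝ × (Fin n → ℝ), (T p).2 - c - ((T p).1 - t) • w = p.2 := by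
        intro p
        simp only [hT, add_sub_cancel_left]
        abel
      simp only [e2] at e1
      rw [e1, iT g hg, gS, ← hμu, ← hS]
      have hi : Integrable (fun y : ℝ × (Fin n → ℝ) => y.2 - c - (y.1 - t) • w)
          (μ.restrict {y | 0 < ε * (y.1 - t)}) :=
        ((hgi.snd.sub (integrable_const _)).sub
          ((hgi.fst.sub (integrable_const _)).smul_const _)).integrableOn
      let ℓ : (Fin n → ℝ) →L[ℝ] ℝ := LinearMap.toContinuousLinearMap
        ((dotProductBilin ℝ ℝ).flip z)
      have := measure_univ_le_lintegral_exp (ℓ.integrable_comp hi)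
        (by rw [ℓ.integral_comp_comm hi, hS0, map_zero])
      rw [Measure.restrict_apply MeasurableSet.univ, Set.univ_inter] at this
      refine this.trans_eq ?_
      rw [hμ, restrict_withDensity sm, lintegral_withDensity_eq_lintegral_mul _ hg]
      · rfl
      · fun_prop
    · intro p q hp hq
      have := hfg (U q) (T p)
      calc g (T p) * F (U q) = f (U q) * g (T p) *
            ENNReal.ofReal (Real.exp ((U q).1 * t + (U q).2 ⬝ᵥ c)) := by rw [hF]; ring
        _ ≤ ENNReal.ofReal (Real.exp (-((U q).1 * (T p).1 + (U q).2 ⬝ᵥ (T p).2))) *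
            ENNReal.ofReal (Real.exp ((U q).1 * t + (U q).2 ⬝ᵥ c)) := by gcongr
        _ = _ := by
          rw [← ENNReal.ofReal_mul (by positivity), ← Real.exp_add]
          congr 2
          simp only [hT, hU, dotProduct_add, dotProduct_smul, smul_eq_mul, dotProduct_comm p.2]
          linear_combination (-p.1 * q.1) * hε
  have k1 := key 1 (by norm_num) (by simpa using hP) (by simpa using hP0)
  have k2 := key (-1) (by norm_num) (by simpa using hQ) (by simpa using hQ0)
  have hFsum : ∫⁻ x, F x ≤ (∫⁻ x in {x | 0 < (1 : ℝ) * (x.1 + x.2 ⬝ᵥ w)}, F x) +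
      ∫⁻ x in {x | 0 < (-1 : ℝ) * (x.1 + x.2 ⬝ᵥ w)}, F x := by
    have hN : ∫⁻ x in {x : ℝ × (Fin n → ℝ) | x.1 + x.2 ⬝ᵥ w = 0}, F x = 0 := by
      refine setLIntegral_measure_zero _ _ ?_
      have mU : MeasurePreserving (fun p : ℝ × (Fin n → ℝ) => (-(p.2 ⬝ᵥ w) + 1 * p.1, p.2)) :=
        measurePreserving_shear_fst (by norm_num) w
      rw [← mU.measure_preimage (measurableSet_eq_fun (by fun_prop)
        (by fun_prop)).nullMeasurableSet]
      simpa using hvol0 0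
    rw [← add_zero (_ + _), ← hN, ← setLIntegral_univ]
    refine le_trans (lintegral_mono_set fun x _ => ?_) ((lintegral_union_le _ _ _).trans
      (add_le_add_left (lintegral_union_le _ _ _) _))
    rcases lt_trichotomy 0 (x.1 + x.2 ⬝ᵥ w) with h | h | h
    · exact .inl (.inl (by simpa using h))
    · exact .inr h.symm
    · exact .inl (.inr (by show 0 < (-1 : ℝ) * _; linarith))
  -- The only use of the centering of `f`: tilting by `(t, c)` does not decrease its integral.
  calc (∫⁻ x, f x) * ∫⁻ y, g y ≤ (∫⁻ x, F x) * ∫⁻ y, g y := mul_le_mul_left (hJ (t, c)) _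
    _ ≤ (_ + _) * ∫⁻ y, g y := by gcongr
    _ = 2 * ((∫⁻ y, g y) / 2 * ∫⁻ x in {x | 0 < (1 : ℝ) * (x.1 + x.2 ⬝ᵥ w)}, F x) +
        2 * ((∫⁻ y, g y) / 2 * ∫⁻ x in {x | 0 < (-1 : ℝ) * (x.1 + x.2 ⬝ᵥ w)}, F x) := by
      rw [← mul_assoc, ← mul_assoc, ENNReal.mul_div_cancel (by simp) (by simp)]
      ring
    _ ≤ 2 * ENNReal.ofReal ((2 * Real.pi) ^ n * (Real.pi / 2)) +
        2 * ENNReal.ofReal ((2 * Real.pi) ^ n * (Real.pi / 2)) := by gcongr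
    _ = _ := by
      rw [← ENNReal.ofReal_ofNat, ← ENNReal.ofReal_mul (by positivity),
        ← ENNReal.ofReal_add (by positivity) (by positivity)]
      congr 1
      ring

/-- The inductive step for functions on `ℝ × ℝⁿ`. -/
theorem FunctionalSantalo.prod (hn : FunctionalSantalo n) {f g : ℝ × (Fin n → ℝ) → ℝ≥0∞}
    (hf : Measurable f) (hg : Measurable g)
    (hJ : ∀ z : ℝ × (Fin n → ℝ), ∫⁻ x, f x ≤
      ∫⁻ x, f x * ENNReal.ofReal (Real.exp (x.1 * z.1 + x.2 ⬝ᵥ z.2)))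
    (hfg : ∀ x y, f x * g y ≤ ENNReal.ofReal (Real.exp (-(x.1 * y.1 + x.2 ⬝ᵥ y.2)))) :
    (∫⁻ x, f x) * ∫⁻ y, g y ≤ ENNReal.ofReal ((2 * Real.pi) ^ (n + 1)) := by
  -- Truncating in space and in height gives finite mass and first moment; monotone convergence
  -- recovers `g`. Duality with `f` survives since `G k ≤ g`.
  let G : ℕ → ℝ × (Fin n → ℝ) → ℝ≥0∞ := fun k =>
    (Metric.closedBall 0 (k : ℝ)).indicator fun y => min (g y) k
  have hGm : ∀ k, Measurable (G k) := fun k =>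
    (hg.min measurable_const).indicator measurableSet_closedBall
  have hGle : ∀ k y, G k y ≤ g y := fun k y =>
    Set.indicator_apply_le' (fun _ => min_le_left _ _) fun _ => zero_le
  have hGsup : ∀ y, ⨆ k, G k y = g y := by
    intro y
    refine le_antisymm (iSup_le fun k => hGle k y) (le_of_forall_lt fun b hb => ?_)
    obtain ⟨k, hk⟩ := ENNReal.exists_nat_gt hb.ne_top
    obtain ⟨l, hl⟩ := exists_nat_ge ‖y‖
    refine lt_iSup_iff.2 ⟨max k l, ?_⟩
    have hy : y ∈ Metric.closedBall (0 : ℝ × (Fin n → ℝ)) ((max k l : ℕ) : ℝ) := by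
      rw [mem_closedBall_zero_iff]
      exact hl.trans (by simp)
    simp only [G, Set.indicator_of_mem hy]
    refine lt_min hb (hk.trans_le ?_)
    exact_mod_cast le_max_left k l
  have hmono : Monotone G := by
    intro k l hkl y
    refine Set.indicator_apply_le fun hy => ?_
    have hy' := Metric.closedBall_subset_closedBall (Nat.cast_le (α := ℝ).2 hkl) hy
    simp only [G, Set.indicator_of_mem hy']
    gcongr
  have : ∫⁻ y, g y = ⨆ k, ∫⁻ y, G k y := by
    rw [← lintegral_iSup hGm hmono]
    simp_rw [hGsup]
  rw [this, ENNReal.mul_iSup]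
  refine iSup_le fun k => ?_
  have hfin : ∫⁻ y, G k y ≠ ⊤ := by
    refine ne_top_of_le_ne_top (b := ∫⁻ y in Metric.closedBall (0 : ℝ × (Fin n → ℝ)) (k : ℝ), k) ?_ ?_
    · rw [setLIntegral_const]
      exact ENNReal.mul_ne_top (by simp) measure_closedBall_lt_top.ne
    · rw [← lintegral_indicator measurableSet_closedBall]
      exact lintegral_mono fun y => Set.indicator_le_indicator (min_le_right _ _)
  have : IsFiniteMeasure ((volume : Measure (ℝ × (Fin n → ℝ))).withDensity (G k)) :=
    ⟨by simpa using hfin.lt_top⟩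
  refine hn.prod_of_integrable hf (hGm k) hfin ?_ hJ fun x y => (mul_le_mul_right (hGle k y) _).trans (hfg x y)
  refine Integrable.of_bound (by fun_prop) (k : ℝ) ?_
  rw [ae_withDensity_iff (hGm k)]
  refine .of_forall fun y hy => ?_
  by_contra hy'
  exact hy (Set.indicator_of_notMem (by simpa using hy') _)

theorem functionalSantalo : ∀ n, FunctionalSantalo n
  | 0 => functionalSantalo_zero
  | n + 1 => by
    intro f g hf hg hJ hfg
    let e := (MeasurableEquiv.piFinSuccAbove (fun _ : Fin (n + 1) => ℝ) 0).symm
    have me : MeasurePreserving e := (volume_preserving_piFinSuccAbove _ 0).symm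
    have dot : ∀ x y, e x ⬝ᵥ e y = x.1 * y.1 + x.2 ⬝ᵥ y.2 := by
      intro x y
      simp [e, dotProduct, Fin.sum_univ_succ, MeasurableEquiv.piFinSuccAbove]
    rw [← me.lintegral_comp hf, ← me.lintegral_comp hg]
    refine (functionalSantalo n).prod (hf.comp me.measurable) (hg.comp me.measurable) ?_ ?_
    · intro z
      rw [me.lintegral_comp hf]
      refine (hJ (e z)).trans_eq ?_
      rw [← me.lintegral_comp (by fun_prop)]
      simp_rw [dot]
    · intro x y
      rw [← dot]
      exact hfg _ _

/-! ### From functions to sets: radial Gaussians. -/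

open scoped Pointwise

theorem lintegral_Ioi_mul_exp_neg_sq {a : ℝ} (ha : 0 ≤ a) :
    ∫⁻ t in Set.Ioi a, ENNReal.ofReal (t * Real.exp (-(t ^ 2 / 2))) =
      ENNReal.ofReal (Real.exp (-(a ^ 2 / 2))) := by
  have hd : ∀ t ∈ Set.Ici a, HasDerivAt (fun t : ℝ => -Real.exp (-(t ^ 2 / 2)))
      (t * Real.exp (-(t ^ 2 / 2))) t := by
    intro t _
    refine ((((hasDerivAt_pow 2 t).div_const 2).fun_neg.exp).fun_neg).congr_deriv ?_
    push_cast
    ring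
  have hp : ∀ t ∈ Set.Ioi a, 0 ≤ t * Real.exp (-(t ^ 2 / 2)) := fun t ht =>
    mul_nonneg (ha.trans (le_of_lt ht)) (Real.exp_pos _).le
  have hl : Filter.Tendsto (fun t : ℝ => -Real.exp (-(t ^ 2 / 2))) .atTop (𝓝 (-0)) := by
    refine (Real.tendsto_exp_atBot.comp (Filter.tendsto_neg_atTop_atBot.comp ?_)).neg
    exact (Filter.tendsto_pow_atTop two_ne_zero).atTop_div_const two_pos
  rw [← ofReal_integral_eq_lintegral_ofReal
    (integrableOn_Ioi_deriv_of_nonneg' hd hp hl)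
    ((ae_restrict_iff' measurableSet_Ioi).2 (.of_forall hp)),
    integral_Ioi_of_hasDerivAt_of_nonneg' hd hp hl]
  simp

section radialGauss

variable {E : Type*} [NormedAddCommGroup E] [InnerProductSpace ℝ E]

/-- The function `exp (-p² / 2)`, where `p` is the gauge of the set `S`, when `S` is star-shaped
about the origin. -/
noncomputable def radialGauss (S : Set E) (x : E) : ℝ≥0∞ :=
  ∫⁻ t in Set.Ioi (0 : ℝ), ENNReal.ofReal (t * Real.exp (-(t ^ 2 / 2))) *
    S.indicator 1 (t⁻¹ • x)

theorem radialGauss_ball (x : E) :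
    radialGauss (Metric.ball 0 1) x = ENNReal.ofReal (Real.exp (-(‖x‖ ^ 2 / 2))) := by
  rw [← lintegral_Ioi_mul_exp_neg_sq (norm_nonneg x), radialGauss,
    ← lintegral_indicator measurableSet_Ioi, ← lintegral_indicator measurableSet_Ioi]
  refine lintegral_congr fun t => ?_
  by_cases ht : 0 < t
  · rw [Set.indicator_of_mem (Set.mem_Ioi.2 ht)]
    have : t⁻¹ • x ∈ Metric.ball (0 : E) 1 ↔ t ∈ Set.Ioi ‖x‖ := by
      rw [mem_ball_zero_iff, norm_smul, norm_inv, Real.norm_of_nonneg ht.le, inv_mul_lt_iff₀ ht,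
        mul_one, Set.mem_Ioi]
    by_cases h : t ∈ Set.Ioi ‖x‖
    · rw [Set.indicator_of_mem (this.2 h), Set.indicator_of_mem h]; simp
    · rw [Set.indicator_of_notMem (mt this.1 h), Set.indicator_of_notMem h]; simp
  · rw [Set.indicator_of_notMem (by simpa using ht), Set.indicator_of_notMem]
    simp only [Set.mem_Ioi, not_lt] at ht ⊢
    exact ht.trans (norm_nonneg x)

theorem radialGauss_le {S : Set E} {x : E} {p : ℝ} (hp : 0 ≤ p)
    (h : ∀ t > 0, t⁻¹ • x ∈ S → p ≤ t) :
    radialGauss S x ≤ ENNReal.ofReal (Real.exp (-(p ^ 2 / 2))) := by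
  rw [← lintegral_Ioi_mul_exp_neg_sq hp, radialGauss, setLIntegral_congr (Ioi_ae_eq_Ici (a := p)),
    ← lintegral_indicator measurableSet_Ioi, ← lintegral_indicator measurableSet_Ici]
  refine lintegral_mono fun t => ?_
  by_cases ht : 0 < t
  · rw [Set.indicator_of_mem (Set.mem_Ioi.2 ht)]
    by_cases hx : t⁻¹ • x ∈ S
    · rw [Set.indicator_of_mem (Set.mem_Ici.2 (h t ht hx)), Set.indicator_of_mem hx]; simp
    · rw [Set.indicator_of_notMem hx]; simp
  · rw [Set.indicator_of_notMem (by simpa using ht)]; simp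

theorem radialGauss_eq_zero {S : Set E} {x : E} (h : ∀ t > (0 : ℝ), t⁻¹ • x ∉ S) :
    radialGauss S x = 0 := by
  rw [radialGauss, setLIntegral_congr_fun (g := 0) measurableSet_Ioi]
  · simp
  · intro t ht
    simp [Set.indicator_of_notMem (h t ht)]

/-- When both gauges `p`, `p'` are finite, polarity gives `⟨x, y⟩ ≤ p(x) p'(y) ≤ (p(x)² + p'(y)²) /
2`. Here the gauges are infima over admissible dilations; neither set need be star-shaped. -/
theorem radialGauss_mul_radialGauss_le {S S' : Set E} (hSS' : ∀ a ∈ S, ∀ b ∈ S', ⟪a, b⟫ ≤ 1)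
    (x y : E) : radialGauss S x * radialGauss S' y ≤ ENNReal.ofReal (Real.exp (-⟪x, y⟫)) := by
  set T := {t : ℝ | 0 < t ∧ t⁻¹ • x ∈ S} with hT
  set T' := {t : ℝ | 0 < t ∧ t⁻¹ • y ∈ S'} with hT'
  rcases T.eq_empty_or_nonempty with h | h
  · rw [radialGauss_eq_zero fun t ht hx => (h ▸ (⟨ht, hx⟩ : t ∈ T) : t ∈ (∅ : Set ℝ))]; simp
  rcases T'.eq_empty_or_nonempty with h' | h'
  · rw [radialGauss_eq_zero (S := S')
      fun t ht hx => (h' ▸ (⟨ht, hx⟩ : t ∈ T') : t ∈ (∅ : Set ℝ))]; simp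
  have hp : 0 ≤ sInf T := Real.sInf_nonneg fun t ht => ht.1.le
  have hp' : 0 ≤ sInf T' := Real.sInf_nonneg fun t ht => ht.1.le
  have bT : BddBelow T := ⟨0, fun t ht => ht.1.le⟩
  have bT' : BddBelow T' := ⟨0, fun t ht => ht.1.le⟩
  have hts : ∀ t ∈ T, ∀ s ∈ T', ⟪x, y⟫ ≤ t * s := by
    rintro t ⟨ht, hx⟩ s ⟨hs, hy⟩
    have := hSS' _ hx _ hy
    rw [real_inner_smul_left, real_inner_smul_right, ← mul_assoc, ← mul_inv,
      inv_mul_le_iff₀ (by positivity), mul_one] at this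
    exact this
  have hinf : ⟪x, y⟫ ≤ sInf T * sInf T' := by
    have h1 : ∀ t ∈ T, ⟪x, y⟫ ≤ t * sInf T' := by
      intro t ht
      rw [← div_le_iff₀' ht.1]
      exact le_csInf h' fun s hs => (div_le_iff₀' ht.1).2 (hts t ht s hs)
    rcases hp'.eq_or_lt with h0 | h0
    · obtain ⟨t, ht⟩ := h
      simpa [← h0] using h1 t ht
    · rw [← div_le_iff₀ h0]
      exact le_csInf h fun t ht => (div_le_iff₀ h0).2 (h1 t ht)
  calc radialGauss S x * radialGauss S' y ≤ ENNReal.ofReal (Real.exp (-(sInf T ^ 2 / 2))) *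
        ENNReal.ofReal (Real.exp (-(sInf T' ^ 2 / 2))) := by
        gcongr
        · exact radialGauss_le hp fun t ht hx => csInf_le bT ⟨ht, hx⟩
        · exact radialGauss_le hp' fun t ht hx => csInf_le bT' ⟨ht, hx⟩
    _ ≤ _ := by
        rw [← ENNReal.ofReal_mul (by positivity), ← Real.exp_add]
        refine ENNReal.ofReal_le_ofReal (Real.exp_le_exp.2 ?_)
        nlinarith [sq_nonneg (sInf T - sInf T')]

variable [FiniteDimensional ℝ E] [MeasurableSpace E] [BorelSpace E]

theorem measurable_radialGauss_integrand {S : Set E} (hS : MeasurableSet S) :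
    Measurable fun p : ℝ × E => ENNReal.ofReal (p.1 * Real.exp (-(p.1 ^ 2 / 2))) *
      S.indicator (1 : E → ℝ≥0∞) (p.1⁻¹ • p.2) := by
  have : Measurable (S.indicator (1 : E → ℝ≥0∞)) := measurable_one.indicator hS
  fun_prop

theorem measurable_radialGauss {S : Set E} (hS : MeasurableSet S) :
    Measurable (radialGauss S) :=
  (measurable_radialGauss_integrand hS).lintegral_prod_left'

/-- Fubini: a radial Gaussian is a mixture of indicators of the dilates `t • S`, so volume and
centering pass from `S` to it. -/
theorem lintegral_radialGauss_mul {S : Set E} (hS : MeasurableSet S) {F : E → ℝ≥0∞}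
    (hF : Measurable F) :
    ∫⁻ x, radialGauss S x * F x = ∫⁻ t in Set.Ioi (0 : ℝ),
      ENNReal.ofReal (t * Real.exp (-(t ^ 2 / 2))) * ∫⁻ x in t • S, F x := by
  have hm := measurable_radialGauss_integrand hS
  calc ∫⁻ x, radialGauss S x * F x = ∫⁻ x, ∫⁻ t in Set.Ioi (0 : ℝ),
        ENNReal.ofReal (t * Real.exp (-(t ^ 2 / 2))) * S.indicator 1 (t⁻¹ • x) * F x := by
        refine lintegral_congr fun x => ?_
        rw [lintegral_mul_const, radialGauss]
        exact hm.comp measurable_prodMk_right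
    _ = ∫⁻ t in Set.Ioi (0 : ℝ), ∫⁻ x,
        ENNReal.ofReal (t * Real.exp (-(t ^ 2 / 2))) * S.indicator 1 (t⁻¹ • x) * F x := by
        refine lintegral_lintegral_swap (Measurable.aemeasurable ?_)
        exact (hm.comp measurable_swap).mul (hF.comp measurable_fst)
    _ = _ := by
        refine setLIntegral_congr_fun measurableSet_Ioi fun t (ht : 0 < t) => ?_
        simp_rw [mul_assoc]
        rw [lintegral_const_mul' _ _ ENNReal.ofReal_ne_top,
          ← lintegral_indicator (hS.const_smul₀ t)]
        congr 1
        refine lintegral_congr fun x => ?_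
        by_cases h : x ∈ t • S
        · rw [Set.indicator_of_mem h, Set.indicator_of_mem
            ((Set.mem_smul_set_iff_inv_smul_mem₀ ht.ne' _ _).1 h)]
          simp
        · rw [Set.indicator_of_notMem h, Set.indicator_of_notMem
            (fun h' => h ((Set.mem_smul_set_iff_inv_smul_mem₀ ht.ne' _ _).2 h'))]
          simp

variable (E) in
/-- The integral of the Gaussian over the unit ball normalised by its volume. -/
noncomputable def gaussBallRatio : ℝ≥0∞ :=
  ∫⁻ t in Set.Ioi (0 : ℝ),
    ENNReal.ofReal (t * Real.exp (-(t ^ 2 / 2))) * ENNReal.ofReal (t ^ Module.finrank ℝ E)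

theorem lintegral_radialGauss {S : Set E} (hS : MeasurableSet S) :
    ∫⁻ x, radialGauss S x = gaussBallRatio E * volume S := by
  have := lintegral_radialGauss_mul hS (F := 1) measurable_one
  simp only [Pi.one_apply, mul_one, setLIntegral_one] at this
  rw [this, gaussBallRatio, ← lintegral_mul_const _ (by fun_prop)]
  refine setLIntegral_congr_fun measurableSet_Ioi fun t (ht : 0 < t) => ?_
  rw [Measure.addHaar_smul, abs_of_pos (pow_pos ht _), mul_assoc]

/-- For the unit ball the radial Gaussian is the standard Gaussian. This expresses `π` in terms of
the volume of the ball without computing either factor. -/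
theorem gaussBallRatio_mul_volume_ball :
    gaussBallRatio E * volume (Metric.ball (0 : E) 1) =
      ENNReal.ofReal ((2 * Real.pi) ^ (Module.finrank ℝ E / 2 : ℝ)) := by
  rw [← lintegral_radialGauss measurableSet_ball]
  simp_rw [radialGauss_ball]
  have h := GaussianFourier.integral_rexp_neg_mul_sq_norm (V := E) (b := 1 / 2) (by norm_num)
  rw [← ofReal_integral_eq_lintegral_ofReal]
  · congr 1
    rw [show 2 * Real.pi = Real.pi / (1 / 2) by ring, ← h]
    congr 1 with x
    ring_nf
  · have : (∫ x : E, Real.exp (-(1 / 2) * ‖x‖ ^ 2)) ≠ 0 := by rw [h]; positivity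
    have := Integrable.of_integral_ne_zero this
    convert this using 3
    ring
  · exact .of_forall fun _ => (Real.exp_pos _).le

theorem gaussBallRatio_ne_zero : gaussBallRatio E ≠ 0 := by
  intro h
  have := gaussBallRatio_mul_volume_ball (E := E)
  rw [h, zero_mul, eq_comm, ENNReal.ofReal_eq_zero] at this
  exact absurd this (by push Not; positivity)

theorem gaussBallRatio_ne_top : gaussBallRatio E ≠ ⊤ := by
  intro h
  have := gaussBallRatio_mul_volume_ball (E := E)
  rw [h, ENNReal.top_mul (Metric.measure_ball_pos _ _ one_pos).ne'] at this
  exact ENNReal.ofReal_ne_top this.symm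

theorem lintegral_radialGauss_le_mul_exp {S : Set E} (hS : MeasurableSet S)
    (hSb : Bornology.IsBounded S) {z : E} (hz : ∫ x in S, ⟪x, z⟫ = 0) :
    ∫⁻ x, radialGauss S x ≤ ∫⁻ x, radialGauss S x * ENNReal.ofReal (Real.exp ⟪x, z⟫) := by
  have h1 := lintegral_radialGauss_mul hS (F := 1) measurable_one
  simp only [Pi.one_apply, mul_one, setLIntegral_one] at h1
  rw [h1, lintegral_radialGauss_mul hS (by fun_prop)]
  refine setLIntegral_mono' measurableSet_Ioi fun t (ht : 0 < t) => ?_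
  gcongr
  have hb : Bornology.IsBounded (t • S) := hSb.smul₀ t
  have hfin : volume (t • S) ≠ ⊤ := hb.measure_lt_top.ne
  have : IsFiniteMeasure (volume.restrict (t • S)) := ⟨by simpa using hfin.lt_top⟩
  have := measure_univ_le_lintegral_exp (μ := volume.restrict (t • S)) (φ := fun x => ⟪x, z⟫) ?_ ?_
  · simpa using this
  · obtain ⟨C, hC⟩ := hb.exists_norm_le
    refine Integrable.of_bound (by fun_prop) (C * ‖z‖) ?_
    refine (ae_restrict_iff' (hS.const_smul₀ t)).2 (.of_forall fun x hx => ?_)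
    exact (norm_inner_le_norm x z).trans (by gcongr; exact hC x hx)
  · have := Measure.setIntegral_comp_smul_of_pos (volume : Measure E) (fun x => ⟪x, z⟫) S ht
    simp only [real_inner_smul_left] at this
    rw [integral_const_mul, hz, mul_zero, eq_comm, smul_eq_zero] at this
    exact this.resolve_left (by positivity)

end radialGauss

/-! ### The Blaschke–Santaló inequality in a half-space. -/

namespace Capillary

variable {n : ℕ}

/-- The splitting of `ℝ^{n+1}` into height and horizontal part. -/
noncomputable def heightSplit (n : ℕ) : ℝ × (Fin n → ℝ) ≃ᵐ Space n :=
  (MeasurableEquiv.piFinSuccAbove (fun _ : Fin (n + 1) => ℝ) (Fin.last n)).symm.trans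
    (MeasurableEquiv.toLp 2 (Fin (n + 1) → ℝ))

theorem measurePreserving_heightSplit : MeasurePreserving (heightSplit n) :=
  (PiLp.volume_preserving_toLp (Fin (n + 1))).comp
    (volume_preserving_piFinSuccAbove (fun _ : Fin (n + 1) => ℝ) (Fin.last n)).symm

theorem height_heightSplit (p : ℝ × (Fin n → ℝ)) : height (heightSplit n p) = p.1 := by
  simp [height, heightSplit, MeasurableEquiv.piFinSuccAbove]

theorem inner_heightSplit (p q : ℝ × (Fin n → ℝ)) :
    ⟪heightSplit n p, heightSplit n q⟫ = p.1 * q.1 + p.2 ⬝ᵥ q.2 := by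
  simp [heightSplit, MeasurableEquiv.piFinSuccAbove, PiLp.inner_apply, Fin.sum_univ_castSucc,
    dotProduct]
  simp_rw [add_comm, mul_comm]

/-- The Blaschke–Santaló inequality for subsets of a half-space, centered horizontally. -/
theorem volume_mul_volume_le_of_height_pos {S S' : Set (Space n)} (hS : MeasurableSet S)
    (hS' : MeasurableSet S') (hSb : Bornology.IsBounded S) (hSh : ∀ x ∈ S, 0 < height x)
    (hS'h : ∀ x ∈ S', 0 < height x) (hSS' : ∀ a ∈ S, ∀ b ∈ S', ⟪a, b⟫ ≤ 1)
    (hc : ∀ z : Space n, height z = 0 → ∫ x in S, ⟪x, z⟫ = 0) :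
    volume S * volume S' ≤ volume (Metric.ball (0 : Space n) 1) ^ 2 / 4 := by
  have me := measurePreserving_heightSplit (n := n)
  have supp : ∀ {R : Set (Space n)} (F : Space n → ℝ≥0∞), Measurable F →
      (∀ x, radialGauss R x = 0 → F x = 0) → (∀ x ∈ R, 0 < height x) → MeasurableSet R →
      ∫⁻ p in Set.Ioi (0 : ℝ) ×ˢ Set.univ, F (heightSplit n p) = ∫⁻ x, F x := by
    intro R F hF hFR hRh hR
    rw [← me.lintegral_comp hF, ← lintegral_indicator (measurableSet_Ioi.prod .univ)]
    refine lintegral_congr fun p => Set.indicator_apply_eq_self.2 fun hp => hFR _ ?_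
    refine radialGauss_eq_zero fun t ht hx => hp ?_
    have := hRh _ hx
    have e : height (t⁻¹ • heightSplit n p) = t⁻¹ * p.1 := by
      rw [← height_heightSplit p]; simp [height]
    rw [e] at this
    simpa using (mul_pos_iff_of_pos_left (inv_pos.2 ht)).1 this
  have key := (functionalSantalo n).halfSpace
    (A := fun p => radialGauss S (heightSplit n p))
    (B := fun p => radialGauss S' (heightSplit n p))
    ((measurable_radialGauss hS).comp me.measurable)
    ((measurable_radialGauss hS').comp me.measurable) (fun z => ?_) (fun p q _ _ => ?_)
  · rw [supp _ (measurable_radialGauss hS) (fun _ h => h) hSh hS,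
      supp _ (measurable_radialGauss hS') (fun _ h => h) hS'h hS', lintegral_radialGauss hS,
      lintegral_radialGauss hS'] at key
    set κ := gaussBallRatio (Space n)
    have hκ0 : κ ≠ 0 := gaussBallRatio_ne_zero
    have hκt : κ ≠ ⊤ := gaussBallRatio_ne_top
    -- `(2π)^n (π / 2) = (2π)^(n+1) / 4`; this is the source of the quarter.
    have hb : ENNReal.ofReal ((2 * Real.pi) ^ n * (Real.pi / 2)) =
        (κ * volume (Metric.ball (0 : Space n) 1)) ^ 2 / 4 := by
      rw [gaussBallRatio_mul_volume_ball, ← ENNReal.ofReal_pow (by positivity),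
        ← ENNReal.ofReal_ofNat 4, ← ENNReal.ofReal_div_of_pos (by norm_num),
        ← Real.rpow_mul_natCast (by positivity)]
      congr 1
      rw [finrank_euclideanSpace, Fintype.card_fin]
      push_cast
      rw [div_mul_cancel₀ _ two_ne_zero, Real.rpow_add_one (by positivity), Real.rpow_natCast]
      ring
    rw [hb] at key
    have e1 : κ * volume S * (κ * volume S') = κ ^ 2 * (volume S * volume S') := by ring
    rw [e1, mul_pow, mul_div_assoc, ENNReal.mul_le_mul_iff_right (by positivity) (by finiteness)]
      at key
    exact key
  · have hz := lintegral_radialGauss_le_mul_exp hS hSb (hc (heightSplit n (0, z))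
      (height_heightSplit _))
    rw [← supp _ (measurable_radialGauss hS) (fun _ h => h) hSh hS,
      ← supp (R := S) (fun x => radialGauss S x * _)
        ((measurable_radialGauss hS).mul (by fun_prop)) (fun _ h => by simp [h]) hSh hS] at hz
    simpa [inner_heightSplit] using hz
  · rw [← inner_heightSplit]
    exact radialGauss_mul_radialGauss_le hSS' _ _

end Capillary

/-! ### Convexity, and the projection of a capillary body to the hyperplane. -/

theorem exists_mem_segment_frontier {E : Type*} [AddCommGroup E] [Module ℝ E] [TopologicalSpace E]
    [ContinuousAdd E] [ContinuousSMul ℝ E] {K : Set E} (hK : IsClosed K) {a b : E} (ha : a ∈ K)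
    (hb : b ∉ K) : ∃ c ∈ segment ℝ a b, c ∈ frontier K := by
  by_contra! h
  have hs : ∀ c ∈ segment ℝ a b, c ∈ K → c ∈ interior K := fun c hc hcK => by
    by_contra hci
    exact h c hc (by rw [hK.frontier_eq]; exact ⟨hcK, hci⟩)
  obtain ⟨c, -, hc, hc'⟩ := (convex_segment (𝕜 := ℝ) a b).isPreconnected (interior K) Kᶜ
    isOpen_interior hK.isOpen_compl
    (fun c hc => (em (c ∈ K)).imp (hs c hc) id) ⟨a, left_mem_segment ℝ a b, hs a
      (left_mem_segment ℝ a b) ha⟩ ⟨b, right_mem_segment ℝ a b, hb⟩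
  exact hc' (interior_subset hc)

/-- If the directional derivative is negative, the function decreases to first order. -/
theorem eventually_lt_of_fderiv_neg {E : Type*} [NormedAddCommGroup E] [NormedSpace ℝ E]
    {f : E → ℝ} {p d : E} {f' : E →L[ℝ] ℝ} (hf : HasFDerivAt f f' p) (hd : f' d < 0) :
    ∀ᶠ t : ℝ in 𝓝[>] 0, f (p + t • d) < f p := by
  have h1 : HasDerivAt (fun t : ℝ => p + t • d) d 0 := by
    simpa using ((hasDerivAt_id (0 : ℝ)).smul_const d).const_add p
  have h2 : HasDerivAt (fun t : ℝ => f (p + t • d)) (f' d) 0 :=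
    HasFDerivAt.comp_hasDerivAt (0 : ℝ) (by simpa using hf) h1
  filter_upwards [h2.tendsto_slope_zero_right.eventually (gt_mem_nhds hd), self_mem_nhdsWithin]
    with t ht (ht0 : 0 < t)
  simp only [zero_add, zero_smul, add_zero, smul_eq_mul] at ht
  by_contra! h
  exact absurd ht (not_lt.2 (mul_nonneg (inv_pos.2 ht0).le (sub_nonneg.2 h)))

/-- The average of a convex body lies in its interior. -/
theorem Convex.average_id_mem_interior {E : Type*} [NormedAddCommGroup E] [NormedSpace ℝ E]
    [FiniteDimensional ℝ E] [MeasurableSpace E] [BorelSpace E] (μ : Measure E) [μ.IsAddHaarMeasure]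
    {K : Set E} (hc : Convex ℝ K) (hK : IsCompact K) (hi : (interior K).Nonempty) :
    (⨍ x in K, x ∂μ) ∈ interior K := by
  by_contra hb
  set b := ⨍ x in K, x ∂μ with hbdef
  obtain ⟨ℓ, hℓ⟩ := geometric_hahn_banach_open_point hc.interior isOpen_interior hb
  have hint : IntegrableOn (fun x : E => x) K μ := continuousOn_id.integrableOn_compact hK
  have hμK : μ K ≠ ⊤ := hK.measure_lt_top.ne
  have hμi : 0 < μ (interior K) := isOpen_interior.measure_pos μ hi
  have hμ0 : μ K ≠ 0 := (hμi.trans_le (measure_mono interior_subset)).ne'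
  have hle : ∀ x ∈ K, ℓ x ≤ ℓ b := by
    intro x hx
    have hcl : x ∈ closure (interior K) := by
      rw [hc.closure_interior_eq_closure_of_nonempty_interior hi]
      exact subset_closure hx
    exact closure_minimal (fun y hy => (hℓ y hy).le)
      (isClosed_le ℓ.continuous continuous_const) hcl
  have hconst : IntegrableOn (fun _ : E => ℓ b) K μ := integrableOn_const hμK
  -- The function `ℓ b - ℓ` is nonnegative on `K` and positive on its interior, yet has integral
  -- zero.
  have h0 : ∫ x in K, (ℓ b - ℓ x) ∂μ = 0 := by
    rw [integral_sub hconst (ℓ.integrable_comp hint), ℓ.integral_comp_comm hint,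
      setIntegral_const, hbdef, setAverage_eq, map_smul, smul_eq_mul, smul_eq_mul, ← mul_assoc,
      mul_inv_cancel₀, one_mul, sub_self]
    rw [measureReal_def]
    exact (ENNReal.toReal_pos hμ0 hμK).ne'
  have hpos : 0 < ∫ x in K, (ℓ b - ℓ x) ∂μ := by
    refine (setIntegral_pos_iff_support_of_nonneg_ae ?_ (hconst.sub (ℓ.integrable_comp hint))).2 ?_
    · exact (ae_restrict_iff' hK.measurableSet).2 (.of_forall fun x hx => sub_nonneg.2 (hle x hx))
    · exact hμi.trans_le (measure_mono fun x hx =>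
        ⟨(sub_pos.2 (hℓ x hx)).ne', interior_subset hx⟩)
  exact hpos.ne' h0

namespace Capillary

variable {n : ℕ}

theorem height_add (x y : Space n) : height (x + y) = height x + height y := rfl

theorem height_sub (x y : Space n) : height (x - y) = height x - height y := rfl

theorem height_smul (c : ℝ) (x : Space n) : height (c • x) = c * height x := rfl

theorem height_e : height (e n) = -1 := by simp [height, e]

theorem inner_e (x : Space n) : ⟪x, e n⟫ = -height x := by
  simp [height, e, EuclideanSpace.inner_single_right]

theorem norm_e : ‖e n‖ = 1 := by simp [e]

theorem continuous_height : Continuous (height : Space n → ℝ) := by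
  unfold height; fun_prop

theorem isClosed_hyperplane : IsClosed (hyperplane n) :=
  isClosed_eq continuous_height continuous_const

theorem convex_hyperplane : Convex ℝ (hyperplane n) := by
  intro x hx y hy a b _ _ _
  have hx : height x = 0 := hx
  have hy : height y = 0 := hy
  simp [hyperplane, height_add, height_smul, hx, hy]

theorem convex_openHalfSpace : Convex ℝ (openHalfSpace n) := by
  intro x hx y hy a b ha hb hab
  have hx : 0 < height x := hx
  have hy : 0 < height y := hy
  show 0 < height _
  rw [height_add, height_smul, height_smul]
  rcases ha.eq_or_lt with rfl | ha
  · simp_all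
  · positivity

theorem height_pos_of_mem_interior {K : Set (Space n)} (hK : K ⊆ closedHalfSpace n) {x : Space n}
    (hx : x ∈ interior K) : 0 < height x := by
  have hc : Continuous fun t : ℝ => x + t • e n := by fun_prop
  have : ∀ᶠ t : ℝ in 𝓝 0, x + t • e n ∈ K :=
    hc.continuousAt.eventually_mem (by simpa using mem_interior_iff_mem_nhds.1 hx)
  obtain ⟨t, ht, ht0⟩ :=
    ((this.filter_mono nhdsWithin_le_nhds).and (self_mem_nhdsWithin (s := Set.Ioi 0))).exists
  have h1 : 0 ≤ height (x + t • e n) := hK ht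
  have h2 : (0 : ℝ) < t := ht0
  rw [height_add, height_smul, height_e] at h1
  linarith

namespace IsCapillaryConvexBody

variable {θ : ℝ} {K : Set (Space n)}

theorem mem_flatFace (hK : IsCapillaryConvexBody θ K) {x : Space n} (hx : x ∈ K)
    (h0 : height x = 0) : x ∈ flatFace K := by
  refine ⟨?_, h0⟩
  rw [hK.isCompact.isClosed.frontier_eq]
  exact ⟨hx, fun h => (height_pos_of_mem_interior hK.subset_halfSpace h).ne' h0⟩

/-- Near `p` there are points of positive height inside `K` (towards an interior point) and outside;
the segment between them crosses the frontier above the hyperplane. -/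
theorem mem_surface_of_forall_pos (hK : IsCapillaryConvexBody θ K) {p : Space n} (hp : p ∈ K)
    (h : ∀ ε > 0, ∃ y ∉ K, y ∈ Metric.ball p ε ∧ 0 < height y) : p ∈ surface K := by
  refine Metric.mem_closure_iff.2 fun ε hε => ?_
  obtain ⟨y, hyK, hyε, hyh⟩ := h ε hε
  obtain ⟨q, hq⟩ := hK.interior_nonempty
  have hqh := height_pos_of_mem_interior hK.subset_halfSpace hq
  have hc : Continuous fun t : ℝ => p + t • (q - p) := by fun_prop
  have h1 : ∀ᶠ t : ℝ in 𝓝 0, p + t • (q - p) ∈ Metric.ball p ε :=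
    hc.continuousAt.eventually_mem (by simpa using Metric.ball_mem_nhds p hε)
  obtain ⟨t, ht, ht0, ht1⟩ := ((h1.filter_mono nhdsWithin_le_nhds).and
    (Ioo_mem_nhdsGT (zero_lt_one (α := ℝ)))).exists
  have hpq : p + t • (q - p) ∈ K :=
    hK.convex.add_smul_sub_mem hp (interior_subset hq) ⟨ht0.le, ht1.le⟩
  have hph : 0 ≤ height p := hK.subset_halfSpace hp
  have hpqh : p + t • (q - p) ∈ openHalfSpace n := by
    show 0 < height _
    rw [height_add, height_smul, height_sub]
    nlinarith [mul_pos ht0 hqh]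
  obtain ⟨c, hc, hcK⟩ := exists_mem_segment_frontier hK.isCompact.isClosed hpq hyK
  refine ⟨c, ⟨hcK, convex_openHalfSpace.segment_subset hpqh hyh hc⟩, ?_⟩
  rw [dist_comm]
  exact (convex_ball p ε).segment_subset ht hyε hc

/-- A capillary convex body with acute contact angle contains its projection to the hyperplane. -/
theorem projection_mem (hK : IsCapillaryConvexBody θ K) (hθ : 0 < Real.cos θ) {x : Space n}
    (hx : x ∈ K) : x + height x • e n ∈ K := by
  have hxh : 0 ≤ height x := hK.subset_halfSpace hx
  rcases hxh.eq_or_lt with h0 | hxh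
  · simpa [← h0] using hx
  by_contra hxK
  set u := x + height x • e n with hu
  have huh : height u = 0 := by simp [hu, height_add, height_smul, height_e]
  have hne : (K ∩ hyperplane n).Nonempty := by
    obtain ⟨p, hp, hp'⟩ := hK.boundary_nonempty
    exact ⟨p, hK.isCompact.isClosed.closure_subset_iff.2
      (Set.inter_subset_left.trans hK.isCompact.isClosed.frontier_subset) hp, hp'⟩
  have hconv : Convex ℝ (K ∩ hyperplane n) := hK.convex.inter convex_hyperplane
  -- At the point `p` of the flat face nearest to the projection `u`, the horizontal direction `w =
  -- u - p` leaves `K`, so `p` lies on `∂Σ` and the contact condition is available.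
  obtain ⟨p, ⟨hpK, hph⟩, hpmin⟩ := exists_norm_eq_iInf_of_complete_convex hne
    (hK.isCompact.isClosed.inter isClosed_hyperplane).isComplete hconv u
  have hpmin := (norm_eq_iInf_iff_real_inner_le_zero hconv ⟨hpK, hph⟩).1 hpmin
  have hph : height p = 0 := hph
  set w := u - p with hw
  have hw0 : w ≠ 0 := fun h => hxK (by rw [sub_eq_zero.1 h]; exact hpK)
  have hwh : height w = 0 := by simp [hw, height_sub, huh, hph]
  have hout : ∀ t > (0 : ℝ), p + t • w ∉ K := by
    intro t ht h
    have := hpmin _ ⟨h, by simp [hyperplane, height_add, height_smul, hph, hwh]⟩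
    rw [add_sub_cancel_left, real_inner_smul_right, real_inner_self_eq_norm_sq] at this
    have := norm_pos_iff.2 hw0
    nlinarith [mul_pos ht (pow_pos this 2)]
  have hpS : p ∈ surface K := by
    refine hK.mem_surface_of_forall_pos hpK fun ε hε => ?_
    have hc : Continuous fun t : ℝ => p + t • w := by fun_prop
    have h1 : ∀ᶠ t : ℝ in 𝓝 0, p + t • w ∈ Metric.ball p ε :=
      hc.continuousAt.eventually_mem (by simpa using Metric.ball_mem_nhds p hε)
    obtain ⟨t, ht, ht0⟩ :=
      ((h1.filter_mono nhdsWithin_le_nhds).and (self_mem_nhdsWithin (s := Set.Ioi 0))).exists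
    have hc' : Continuous fun s : ℝ => p + t • w + s • -e n := by fun_prop
    have h2 : ∀ᶠ s : ℝ in 𝓝 0, p + t • w + s • -e n ∈ Metric.ball p ε ∩ Kᶜ :=
      hc'.continuousAt.eventually_mem (by
        simp only [zero_smul, add_zero]
        exact (Metric.isOpen_ball.inter hK.isCompact.isClosed.isOpen_compl).mem_nhds
          ⟨ht, hout t ht0⟩)
    obtain ⟨s, hs, hs0⟩ :=
      ((h2.filter_mono nhdsWithin_le_nhds).and (self_mem_nhdsWithin (s := Set.Ioi 0))).exists
    refine ⟨_, hs.2, hs.1, ?_⟩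
    have e1 : height (-e n) = 1 := by simp [height, e]
    have : (0 : ℝ) < s := hs0
    rw [height_add, height_add, height_smul, height_smul, hph, hwh, e1]
    linarith
  obtain ⟨ν, ⟨U, f, hU, hpU, hf, hKU, hg, hν⟩, hcontact⟩ := hK.smooth_contact p hpS
  have hcontact := hcontact hph
  have hfd : HasFDerivAt f (innerSL ℝ (gradient f p)) p :=
    (((hf.differentiableOn (by simp)).differentiableAt
      (hU.mem_nhds hpU)).hasGradientAt).hasFDerivAt
  have hfp : f p ≤ 0 := by
    have : p ∈ K ∩ U := ⟨hpK, hpU⟩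
    rw [hKU] at this
    exact this.2.2
  have hmemU : ∀ d : Space n, ∀ᶠ t : ℝ in 𝓝[>] 0, p + t • d ∈ U := by
    intro d
    have hc : Continuous fun t : ℝ => p + t • d := by fun_prop
    exact (hc.continuousAt.eventually_mem
      (by simpa using hU.mem_nhds hpU)).filter_mono nhdsWithin_le_nhds
  have hwpos : ∀ᶠ t : ℝ in 𝓝[>] 0, 0 < f (p + t • w) := by
    filter_upwards [hmemU w, self_mem_nhdsWithin] with t htU (ht0 : 0 < t)
    by_contra! hft
    have : p + t • w ∈ K ∩ U := by
      rw [hKU]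
      exact ⟨htU, by simp [closedHalfSpace, height_add, height_smul, hph, hwh], hft⟩
    exact hout t ht0 this.1
  have hxle : ∀ᶠ t : ℝ in 𝓝[>] 0, f (p + t • (x - p)) ≤ 0 := by
    filter_upwards [hmemU (x - p), Ioo_mem_nhdsGT (zero_lt_one (α := ℝ))] with t htU ht
    have : p + t • (x - p) ∈ K ∩ U :=
      ⟨hK.convex.add_smul_sub_mem hpK hx ⟨ht.1.le, ht.2.le⟩, htU⟩
    rw [hKU] at this
    exact this.2.2
  have hfp0 : f p = 0 := by
    refine le_antisymm hfp (ge_of_tendsto (x := 𝓝[>] (0 : ℝ)) (f := fun t => f (p + t • w)) ?_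
      (hwpos.mono fun t ht => ht.le))
    have hc : ContinuousAt (fun t : ℝ => f (p + t • w)) 0 :=
      ContinuousAt.comp (by simpa using hfd.continuousAt) (by fun_prop)
    simpa using hc.tendsto.mono_left nhdsWithin_le_nhds
  have h1 : 0 ≤ ⟪gradient f p, w⟫ := by
    by_contra! h
    obtain ⟨t, ht, ht'⟩ := ((eventually_lt_of_fderiv_neg hfd h).and hwpos).exists
    linarith
  have h2 : ⟪gradient f p, x - p⟫ ≤ 0 := by
    by_contra! h
    obtain ⟨t, ht, ht'⟩ := ((eventually_lt_of_fderiv_neg (d := x - p) hfd.neg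
      (by simpa using h)).and hxle).exists
    simp only [Pi.neg_apply] at ht
    linarith
  have h3 : ⟪gradient f p, e n⟫ = -(‖gradient f p‖ * Real.cos θ) := by
    rw [hν, Real.cos_pi_sub, real_inner_smul_left, inv_mul_eq_iff_eq_mul₀ (norm_ne_zero_iff.2 hg)]
      at hcontact
    rw [hcontact]; ring
  -- The contradiction: `∇f` pairs nonnegatively with `w` and positively with `-e`, as the angle is
  -- acute, but nonpositively with `x - p`.
  have h4 : x - p = w - height x • e n := by rw [hw, hu]; abel
  rw [h4, inner_sub_right, real_inner_smul_right, h3] at h2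
  have : 0 < height x * (‖gradient f p‖ * Real.cos θ) := by
    have := norm_pos_iff.2 hg
    positivity
  linarith

theorem projection_mem_flatInterior (hK : IsCapillaryConvexBody θ K) (hθ : 0 < Real.cos θ)
    {b : Space n} (hb : b ∈ interior K) : b + height b • e n ∈ flatInterior K := by
  have h0 : height (b + height b • e n) = 0 := by
    simp [height_add, height_smul, height_e]
  refine ⟨h0, ?_⟩
  have hc : Continuous fun y : Space n => y - height b • e n := by fun_prop
  have : ∀ᶠ y in 𝓝 (b + height b • e n), y - height b • e n ∈ K :=
    hc.continuousAt.eventually_mem (by simpa using mem_interior_iff_mem_nhds.1 hb)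
  filter_upwards [this.filter_mono nhdsWithin_le_nhds, self_mem_nhdsWithin] with y hy hyh
  have hyh : height y = 0 := hyh
  refine hK.mem_flatFace ?_ hyh
  have := hK.projection_mem hθ hy
  simpa [height_sub, height_smul, height_e, hyh] using this

end IsCapillaryConvexBody


/-! ### Comparison of the capillary polar body with the Euclidean one. -/

/-- The map `W ↦ W + c |W| e`, which carries the Euclidean direction `ξ - c e` to `ξ`. -/
noncomputable def capShift (c : ℝ) (W : Space n) : Space n := W + (c * ‖W‖) • e n

theorem hasFDerivAt_capShift (c : ℝ) {W : Space n} (hW : W ≠ 0) :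
    HasFDerivAt (capShift c) (LinearMap.toContinuousLinearMap (LinearMap.transvection
      ((c / ‖W‖) • (innerSL ℝ W : Space n →L[ℝ] ℝ).toLinearMap) (e n))) W := by
  have hn : ‖W‖ ≠ 0 := norm_ne_zero_iff.2 hW
  have h1 := (hasStrictFDerivAt_norm_sq W).hasFDerivAt.sqrt (by positivity)
  have h2 : (fun x : Space n => √(‖x‖ ^ 2)) = fun x => ‖x‖ := by
    ext x; exact Real.sqrt_sq (norm_nonneg x)
  rw [h2] at h1
  have h3 := (hasFDerivAt_id W).add ((h1.const_mul c).smul_const (e n))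
  refine h3.congr_fderiv ?_
  ext1 v
  simp [LinearMap.transvection, Real.sqrt_sq]
  congr 1
  field_simp

/-- The derivative is a transvection with determinant `1 - c height x / |x|`, which is in `(0, 1)`
where the height is positive. -/
theorem volume_capShift_image_le {c : ℝ} (hc : c ∈ Set.Ioo (0 : ℝ) 1) {S : Set (Space n)}
    (hS : MeasurableSet S) (hSh : ∀ x ∈ S, 0 < height x) :
    volume (capShift c '' S) ≤ volume S := by
  have h0 : ∀ x ∈ S, x ≠ 0 := by
    rintro x hx rfl
    exact (hSh 0 hx).ne' rfl
  refine (addHaar_image_le_lintegral_abs_det_fderiv volume hS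
    fun x hx => (hasFDerivAt_capShift c (h0 x hx)).hasFDerivWithinAt).trans ?_
  rw [← setLIntegral_one]
  refine setLIntegral_mono' hS fun x hx => ?_
  rw [ENNReal.ofReal_le_one]
  have hd : (LinearMap.toContinuousLinearMap (LinearMap.transvection
      ((c / ‖x‖) • (innerSL ℝ x : Space n →L[ℝ] ℝ).toLinearMap) (e n))).det =
      1 - c * (height x / ‖x‖) := by
    rw [LinearMap.det_toContinuousLinearMap, LinearMap.transvection.det]
    simp [inner_e]
    ring
  have hx0 := norm_pos_iff.2 (h0 x hx)
  have hle : height x / ‖x‖ ≤ 1 := by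
    rw [div_le_one hx0]
    calc height x ≤ |⟪x, e n⟫| := by rw [inner_e, abs_neg]; exact le_abs_self _
      _ ≤ ‖x‖ * ‖e n‖ := abs_real_inner_le_norm _ _
      _ = ‖x‖ := by rw [norm_e, mul_one]
  have hge : 0 < height x / ‖x‖ := div_pos (hSh x hx) hx0
  rw [hd, abs_le]
  constructor <;> nlinarith [hc.1, hc.2]

namespace IsCapillaryConvexBody

variable {θ : ℝ} {K : Set (Space n)}

theorem surface_subset (hK : IsCapillaryConvexBody θ K) : surface K ⊆ K :=
  hK.isCompact.isClosed.closure_subset_iff.2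
    (Set.inter_subset_left.trans hK.isCompact.isClosed.frontier_subset)

/-- A linear functional which is nonnegative on the upward direction is dominated on `K` by its
values on the surface. -/
theorem exists_mem_surface_inner_le (hK : IsCapillaryConvexBody θ K) {X : Space n} (hX : X ∈ K)
    (hXh : 0 < height X) {W : Space n} (hW : 0 ≤ height W) :
    ∃ Y ∈ surface K, ⟪W, X⟫ ≤ ⟪W, Y⟫ := by
  obtain ⟨C, hC⟩ := hK.isCompact.isBounded.exists_norm_le
  -- Since `-e` points upward, moving from `X` along it until leaving `K` reaches the surface and
  -- does not decrease the pairing with `W`.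
  have hout : X + (2 * C + 1) • -e n ∉ K := by
    intro h
    have h1 := hC _ h
    have h2 := hC _ hX
    have h3 : ‖(2 * C + 1) • -e n‖ = 2 * C + 1 := by
      have : 0 ≤ C := (norm_nonneg X).trans h2
      rw [norm_smul, norm_neg, norm_e, mul_one, Real.norm_of_nonneg (by positivity)]
    have h4 : (2 * C + 1) • -e n = (X + (2 * C + 1) • -e n) - X := by abel
    have := norm_sub_le (X + (2 * C + 1) • -e n) X
    rw [← h4, h3] at this
    linarith
  obtain ⟨Y, hY, hYK⟩ := exists_mem_segment_frontier hK.isCompact.isClosed hX hout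
  rw [segment_eq_image'] at hY
  obtain ⟨t, ht, rfl⟩ := hY
  have hC0 : 0 ≤ C := (norm_nonneg X).trans (hC _ hX)
  have ht0 : 0 ≤ t * (2 * C + 1) := mul_nonneg ht.1 (by positivity)
  have e1 : X + t • (X + (2 * C + 1) • -e n - X) = X + (-(t * (2 * C + 1))) • e n := by
    rw [add_sub_cancel_left, smul_neg, smul_neg, neg_smul, smul_smul]
  simp only [e1] at *
  refine ⟨_, subset_closure ⟨hYK, ?_⟩, ?_⟩
  · show 0 < height _
    rw [height_add, height_smul, height_e]
    linarith
  · rw [inner_add_right, real_inner_smul_right, inner_e]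
    nlinarith [mul_nonneg ht0 hW]

/-- The condition `r u_z(ξ) ≤ 1` means `r h_z(ξ) ≤ ell θ ξ`, and `ell θ ξ ≤ 1`. The inserted origin
is the case `r = 0`. -/
theorem polarBody_subset (hK : IsCapillaryConvexBody θ K) (hθ : 0 < Real.cos θ)
    (hθ' : Real.cos θ < 1) (z : Space n) :
    polarBody θ K z ⊆ (fun Y => Y + z) '' insert 0 (capShift (Real.cos θ) ''
      {W | 0 < height W ∧ ∀ X ∈ K, 0 < height X → ⟪W, X - z⟫ ≤ 1}) := by
  rintro _ ⟨-, r, hr, ξ, ⟨hξh, hξ⟩, hru, rfl⟩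
  refine ⟨r • ξ, ?_, rfl⟩
  rcases hr.eq_or_lt with rfl | hr
  · simp
  have hξh : 0 ≤ height ξ := hξh
  set ν := ξ - Real.cos θ • e n with hν
  have hνh : height ν = height ξ + Real.cos θ := by
    rw [hν, height_sub, height_smul, height_e]; ring
  have hνh0 : 0 < height ν := by linarith
  refine Or.inr ⟨r • ν, ⟨?_, ?_⟩, ?_⟩
  · rw [height_smul]; positivity
  · intro X hX hXh
    have hl : 0 < ell θ ξ := by
      have e1 : ell θ ξ = 1 + Real.cos θ * ⟪ν, e n⟫ := by
        rw [ell, hν, inner_sub_left, real_inner_smul_left, real_inner_self_eq_norm_sq, norm_e,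
          Real.sin_sq]
        ring
      have := abs_le.1 ((abs_real_inner_le_norm ν (e n)).trans_eq (by rw [norm_e, hξ, mul_one]))
      rw [e1]
      nlinarith
    have hl1 : ell θ ξ ≤ 1 := by
      rw [ell, inner_e]
      nlinarith [Real.sin_sq_le_one θ]
    obtain ⟨Y, hY, hXY⟩ := hK.exists_mem_surface_inner_le hX hXh hνh0.le
    have hbdd : BddAbove ((fun X : Space n => ⟪ν, X - z⟫) '' surface K) := by
      have : IsCompact (surface K) := hK.isCompact.of_isClosed_subset isClosed_closure
        hK.surface_subset
      exact (this.image (by fun_prop)).bddAbove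
    have hYs : ⟪ν, Y - z⟫ ≤ support θ K z ξ := le_csSup hbdd ⟨Y, hY, rfl⟩
    rw [capillarySupport, ← mul_div_assoc, div_le_one hl] at hru
    calc ⟪r • ν, X - z⟫ = r * ⟪ν, X - z⟫ := real_inner_smul_left _ _ _
      _ ≤ r * ⟪ν, Y - z⟫ := by
        rw [inner_sub_right, inner_sub_right]; gcongr
      _ ≤ r * support θ K z ξ := by gcongr
      _ ≤ 1 := hru.trans hl1
  · rw [capShift, norm_smul, hξ, Real.norm_of_nonneg hr.le, mul_one, mul_comm, mul_smul,
      ← smul_add, hν, sub_add_cancel]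

/-- The volume product with respect to the projection of the barycenter. -/
theorem volume_mul_volume_polarBody_le (hK : IsCapillaryConvexBody θ K) (hθ : 0 < Real.cos θ)
    (hθ' : Real.cos θ < 1) {b z : Space n} (hb : b = ⨍ x in K, x) (hz : z = b + height b • e n) :
    volume K * volume (polarBody θ K z) ≤ volume (Metric.ball (0 : Space n) 1) ^ 2 / 4 := by
  set S : Set (Space n) := {x | x + z ∈ K ∧ 0 < height x}
  set S' : Set (Space n) := {W | 0 < height W ∧ ∀ X ∈ K, 0 < height X → ⟪W, X - z⟫ ≤ 1}
  have hzh : height z = 0 := by rw [hz, height_add, height_smul, height_e]; ring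
  have hKm := hK.isCompact.measurableSet
  have hS : MeasurableSet S :=
    (hKm.preimage (measurable_add_const z)).inter (continuous_height.measurable measurableSet_Ioi)
  have hS' : MeasurableSet S' := by
    refine (continuous_height.measurable measurableSet_Ioi).inter (IsClosed.measurableSet ?_)
    have : {W : Space n | ∀ X ∈ K, 0 < height X → ⟪W, X - z⟫ ≤ 1} =
        ⋂ X ∈ K, ⋂ _ : 0 < height X, {W | ⟪W, X - z⟫ ≤ 1} := by
      ext W; simp
    change IsClosed {W : Space n | ∀ X ∈ K, 0 < height X → ⟪W, X - z⟫ ≤ 1}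
    rw [this]
    exact isClosed_iInter fun X => isClosed_iInter fun _ => isClosed_iInter fun _ =>
      isClosed_le (by fun_prop) continuous_const
  have hpre : S = (fun x => x + z) ⁻¹' (K ∩ openHalfSpace n) := by
    ext x
    simp [S, openHalfSpace, height_add, hzh]
  -- The frontier of a convex set is null, so removing the flat face changes neither volume nor
  -- barycenter.
  have hae : (K ∩ openHalfSpace n : Set (Space n)) =ᵐ[volume] K := by
    refine (LE.le.eventuallyLE Set.inter_subset_left).antisymm ?_
    have h1 : (interior K : Set (Space n)) =ᵐ[volume] K :=
      interior_ae_eq_of_null_frontier (hK.convex.addHaar_frontier _)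
    refine h1.symm.le.trans (LE.le.eventuallyLE fun x hx => ?_)
    exact ⟨interior_subset hx, height_pos_of_mem_interior hK.subset_halfSpace hx⟩
  have mp : MeasurePreserving (fun x : Space n => x + z) := measurePreserving_add_right volume z
  have hKo : MeasurableSet (K ∩ openHalfSpace n) :=
    hKm.inter (continuous_height.measurable measurableSet_Ioi)
  have hSvol : volume S = volume K := by
    rw [hpre, mp.measure_preimage hKo.nullMeasurableSet, measure_congr hae]
  have hpol : volume (polarBody θ K z) ≤ volume S' := by
    refine (measure_mono (hK.polarBody_subset hθ hθ' z)).trans ?_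
    rw [Set.image_add_right, measure_preimage_add_right, Set.insert_eq]
    refine (measure_union_le _ _).trans ?_
    rw [measure_singleton, zero_add]
    exact volume_capShift_image_le ⟨hθ, hθ'⟩ hS' fun x hx => hx.1
  have hint : IntegrableOn (fun x : Space n => x) K := continuousOn_id.integrableOn_compact hK.isCompact
  calc volume K * volume (polarBody θ K z) ≤ volume S * volume S' := by rw [hSvol]; gcongr
    _ ≤ _ := by
      refine volume_mul_volume_le_of_height_pos hS hS' ?_ (fun x hx => hx.2) (fun x hx => hx.1)
        ?_ ?_
      · obtain ⟨C, hC⟩ := hK.isCompact.isBounded.exists_norm_le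
        refine isBounded_iff_forall_norm_le.2 ⟨C + ‖z‖, fun x hx => ?_⟩
        have := norm_sub_le (x + z) z
        rw [add_sub_cancel_right] at this
        linarith [hC _ hx.1]
      · intro a ha c hc
        have := hc.2 _ ha.1 (by rw [height_add, hzh, add_zero]; exact ha.2)
        rwa [add_sub_cancel_right, real_inner_comm] at this
      · intro ζ hζ
        have h1 := mp.setIntegral_preimage_emb (measurableEmbedding_addRight z)
          (fun y => ⟪y - z, ζ⟫) (K ∩ openHalfSpace n)
        simp only [add_sub_cancel_right] at h1
        rw [hpre, h1, setIntegral_congr_set hae]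
        simp_rw [inner_sub_left]
        have hfin : volume K ≠ ⊤ := hK.isCompact.measure_lt_top.ne
        have h0 : volume.real K ≠ 0 := by
          rw [measureReal_def]
          exact (ENNReal.toReal_pos ((isOpen_interior.measure_pos volume
            hK.interior_nonempty).trans_le (measure_mono interior_subset)).ne' hfin).ne'
        have h2 : ∫ y in K, ⟪y, ζ⟫ = volume.real K * ⟪b, ζ⟫ := by
          simp_rw [real_inner_comm ζ]
          rw [integral_inner hint, hb, setAverage_eq, real_inner_smul_right, ← mul_assoc,
            mul_inv_cancel₀ h0, one_mul]
        have hi1 : Integrable (fun y : Space n => ⟪y, ζ⟫) (volume.restrict K) :=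
          hint.inner_const ζ
        have hi2 : Integrable (fun _ : Space n => ⟪z, ζ⟫) (volume.restrict K) :=
          integrableOn_const hfin
        -- `z` and `b` differ by a multiple of `e`, to which the horizontal vector `ζ` is
        -- orthogonal.
        rw [integral_sub hi1 hi2, h2, setIntegral_const,
          smul_eq_mul, hz, inner_add_left, real_inner_smul_left, real_inner_comm ζ (e n), inner_e, hζ]
        simp

end IsCapillaryConvexBody

end Capillary

theorem proposition2 (n : ℕ) (θ : ℝ) (hθ : θ ∈ Set.Ioo (0 : ℝ) (Real.pi / 2))
    (K : Set (Capillary.Space n)) (hK : Capillary.IsCapillaryConvexBody θ K) :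
    (⨅ z ∈ Capillary.flatInterior K,
        MeasureTheory.volume K * MeasureTheory.volume (Capillary.polarBody θ K z)) ≤
      (1 / 2 : ℝ≥0∞) * MeasureTheory.volume (Metric.ball (0 : Capillary.Space n) 1) ^ 2 := by
  have hcos : 0 < Real.cos θ :=
    Real.cos_pos_of_mem_Ioo ⟨by linarith [hθ.1, Real.pi_pos], hθ.2⟩
  have hcos' : Real.cos θ < 1 := by
    rw [← Real.cos_zero]
    exact Real.cos_lt_cos_of_nonneg_of_le_pi_div_two le_rfl hθ.2.le hθ.1
  have hb := hK.convex.average_id_mem_interior volume hK.isCompact hK.interior_nonempty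
  -- The infimum is bounded by its value at the projected barycenter; what remains is `1/4 ≤ 1/2`.
  refine (iInf₂_le _ (hK.projection_mem_flatInterior hcos hb)).trans
    ((hK.volume_mul_volume_polarBody_le hcos hcos' rfl rfl).trans ?_)
  rw [div_eq_mul_inv, mul_comm, one_div]
  gcongr
  norm_num
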